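/- Let $P$ be a hyperbolic Riemann surface of type $(g,l_h,l_p)$, i.e. of genus $g$ with $l_h$ holes and $l_p$ punctures, let $p\in P$, $n=g+l_h+l_p$ and $m\in\mathbb N$. The product $ab$ in $\pi_1(P,p)$ means the path $b$ followed by the path $a$, $[a,b]=aba^{-1}b^{-1}$, and $\pi_1^0(P,p)$ is the set of nontrivial elements of $\pi_1(P,p)$ that are represented by simple contours. An *$m$-Arf function* is a function $\sigma:\pi_1^0(P,p)\to\mathbb Z/m\mathbb Z$ such that, whenever all arguments of $\sigma$ lie in $\pi_1^0(P,p)$: (i) $\sigma(bab^{-1})=\sigma(a)$; (ii) $\sigma(a^{-1})=-\sigma(a)$; (iii) $\sigma(ab)=\sigma(a)+\sigma(b)$ if $a,b$ are represented by simple contours that intersect only in $p$, with intersection number $\langle a,b\rangle\neq0$; (iv) $\sigma(ab)=\sigma(a)+\sigma(b)-1$ if $a,b$ are represented by simple contours that intersect only in $p$ and whose ends at $p$ occur in the clockwise cyclic order: $a$ leaving, $a$ arriving, $b$ leaving, $b$ arriving (so that $\langle a,b\rangle=0$). A *standard basis* of $\pi_1(P,p)$ is a system of generators $v=\{a_i,b_i\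 (1\le i\le g),\ c_i\ (g<i\le n)\}$ with the single defining relation $\prod_{i=1}^g[a_i,b_i]\prod_{i=g+1}^n c_i=1$, represented by simple contours any two of which intersect only in $p$, such that the contour of $c_i$ encloses a hole for $g<i\le g+l_h$ and a puncture for $g+l_h<i\le n$, and such that the ends of the contours at $p$ occur in the clockwise cyclic order: for $i=1,\dots,g$ successively $a_i$ arriving, $b_i$ leaving, $a_i$ leaving, $b_i$ arriving, and then for $i=g+1,\dots,n$ successively $c_i$ arriving, $c_i$ leaving. A *Dehn twist* takes a standard basis $v$ to a standard basis $v'=\{a_i',b_i',c_i'\}$ by one of the following rules, where elements that are not mentioned do not change, and $c_i:=[a_i,b_i]$ for $i\le g$: 1. ($g\ge1$) $a_1'=a_1b_1$. 2. ($g\ge2$) $a_1'=(a_1a_2)a_1(a_1a_2)^{-1}$, $b_1'=(a_1a_2)a_1^{-1}a_2^{-1}b_1(a_1a_2)^{-1}$, $a_2'=a_1a_2a_1^{-1}$, $b_2'=b_2a_2^{-1}a_1^{-1}$. 3. ($g\ge1$, $n>g$) with $c=c_{g+1}$: $a_g'=(b_g^{-1}c)\,b_g^{-1}(b_g^{-1}c)^{-1}$,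 $b_g'=(b_g^{-1}cb_g)\,c^{-1}b_ga_gb_g^{-1}(b_g^{-1}cb_g)^{-1}$, $c_{g+1}'=b_g^{-1}cb_g$. 4. ($1\le k<g$) $a_k'=a_{k+1}$, $b_k'=b_{k+1}$, $a_{k+1}'=(c_{k+1}^{-1}c_k)a_k(c_{k+1}^{-1}c_k)^{-1}$, $b_{k+1}'=(c_{k+1}^{-1}c_k)b_k(c_{k+1}^{-1}c_k)^{-1}$. 5. ($g<k<n$) $c_k'=c_{k+1}$, $c_{k+1}'=c_{k+1}^{-1}c_kc_{k+1}$. Let $\sigma$ be an $m$-Arf function, and let a Dehn twist of one of these types map the standard basis $v$ to the standard basis $v'$. Let $\alpha_i,\beta_i,\gamma_i$ and $\alpha_i',\beta_i',\gamma_i'$ be the values of $\sigma$ on $a_i,b_i,c_i$ and on $a_i',b_i',c_i'$. Then, in $\mathbb Z/m\mathbb Z$, respectively: 1. $\alpha_1'=\alpha_1+\beta_1$. 2. $\beta_1'=\beta_1-\alpha_1-\alpha_2-1$ and $\beta_2'=\beta_2-\alpha_2-\alpha_1-1$. 3. $\alpha_g'=-\beta_g$ and $\beta_g'=\alpha_g-\gamma_{g+1}-1$.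 4. $\alpha_k'=\alpha_{k+1}$, $\beta_k'=\beta_{k+1}$, $\alpha_{k+1}'=\alpha_k$, $\beta_{k+1}'=\beta_k$. 5. $\gamma_k'=\gamma_{k+1}$, $\gamma_{k+1}'=\gamma_k$. All values that are not mentioned do not change. -/

import Mathlib

open Set
open scoped Manifold ContDiff UpperHalfPlane

noncomputable section

namespace HigherArf

/-- The commutator `[x, y] = x y x⁻¹ y⁻¹`. -/
def groupComm {G : Type*} [Group G] (x y : G) : G := x * y * x⁻¹ * y⁻¹

/-! ### Families indexed like a standard basis -/

/-- A family `a₁, …, a_g, b₁, …, b_g, c_{g+1}, …, c_{g+n}` of elements of `X`.  Indices start at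
zero here: `a i` is `a_{i+1}`, `b i` is `b_{i+1}` and `c j` is `c_{g+j+1}`. -/
@[ext]
structure Family (X : Type*) (g n : ℕ) where
  a : Fin g → X
  b : Fin g → X
  c : Fin n → X

namespace Family

variable {X Y : Type*} {g n : ℕ}

/-- Apply a function to every member of a family. -/
def map (f : X → Y) (v : Family X g n) : Family Y g n :=
  ⟨fun i => f (v.a i), fun i => f (v.b i), fun j => f (v.c j)⟩

/-- The family as a function on its index set. -/
def get (v : Family X g n) : Fin g ⊕ Fin g ⊕ Fin n → X :=
  Sum.elim v.a (Sum.elim v.b v.c)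

/-- The ordered product `∏ [aᵢ, bᵢ] · ∏ cⱼ`, where `[a, b] = a b a⁻¹ b⁻¹`. -/
def relator {G : Type*} [Group G] (v : Family G g n) : G :=
  (List.ofFn fun i => groupComm (v.a i) (v.b i)).prod * (List.ofFn v.c).prod

/-- The free generators. -/
def free (g n : ℕ) : Family (FreeGroup (Fin g ⊕ Fin g ⊕ Fin n)) g n :=
  ⟨fun i => .of (.inl i), fun i => .of (.inr (.inl i)), fun j => .of (.inr (.inr j))⟩

/-- `v` generates the group `G`, with the single defining relation `∏ [aᵢ, bᵢ] · ∏ cⱼ = 1`. -/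
def IsPresentation {G : Type*} [Group G] (v : Family G g n) : Prop :=
  Function.Surjective (FreeGroup.lift v.get) ∧
    (FreeGroup.lift v.get).ker = Subgroup.normalClosure {(free g n).relator}

end Family

/-! ### Directions around a point of the plane -/

/-- The nonzero vectors of the list `l` have pairwise distinct directions, which are met in the
order of the list when one turns once clockwise around the origin. -/
def Clockwise (l : List ℂ) : Prop :=
  ∃ θ : Fin l.length → ℝ, StrictAnti θ ∧ (∀ i j, θ i - θ j < 2 * Real.pi) ∧
    ∀ i, ∃ ρ : ℝ, 0 < ρ ∧ l.get i = ρ * Complex.exp (θ i * Complex.I)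

open Classical in
/-- The intersection index at the origin of two oriented curves, the first of which arrives along
the ray through `aIn` and leaves along the ray through `aOut`, the second of which arrives along
the ray through `bIn` and leaves along the ray through `bOut`: it is `1` if the second curve
crosses the first one from right to left, `-1` if it crosses from left to right, and `0` if the
curves do not cross. -/
def localIndex (aIn aOut bIn bOut : ℂ) : ℤ :=
  if Clockwise [aIn, bOut, aOut, bIn] then 1
  else if Clockwise [aIn, bIn, aOut, bOut] then -1
  else 0

/-! ### Simple contours -/

section Surface

variable {P : Type*} [TopologicalSpace P]

/-- A closed path at `p` without self-intersections, apart from the common end points. -/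
def IsSimpleContour {p : P} (γ : Path p p) : Prop :=
  ∀ s t : unitInterval, γ s = γ t → s = t ∨ (s = 0 ∧ t = 1) ∨ (s = 1 ∧ t = 0)

/-- The class of a contour in the fundamental group.  The product `x * y` in Mathlib's
`FundamentalGroup` is `y` followed by `x`. -/
def contourClass {p : P} (γ : Path p p) : FundamentalGroup P p :=
  FundamentalGroup.fromPath (Path.Homotopic.Quotient.mk γ)

/-- The set `π₁⁰(P, p)` of all nontrivial elements of the fundamental group that are represented
by simple contours. -/
def simpleClasses (P : Type*) [TopologicalSpace P] (p : P) : Set (FundamentalGroup P p) :=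
  {x | x ≠ 1 ∧ ∃ γ : Path p p, IsSimpleContour γ ∧ contourClass γ = x}

/-- In the chart `φ` (which sends `p` to `0`) the contour `γ` starts along the straight ray
through `out` and comes back along the straight ray through `inn`, at constant speed. -/
def HasEnds {p : P} (φ : OpenPartialHomeomorph P ℂ) (γ : Path p p) (out inn : ℂ) : Prop :=
  ∃ ε : ℝ, 0 < ε ∧ ∀ t : unitInterval, (t : ℝ) ≤ ε →
    (γ t ∈ φ.source ∧ φ (γ t) = (t : ℝ) • out) ∧
    (γ (unitInterval.symm t) ∈ φ.source ∧ φ (γ (unitInterval.symm t)) = (t : ℝ) • inn)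

variable [ChartedSpace ℂ P]

/-- A Riemann surface is hyperbolic if its universal covering is the upper half-plane, that is, if
it is the quotient of the upper half-plane by a torsion-free Fuchsian group. -/
def IsHyperbolic (P : Type*) [TopologicalSpace P] [ChartedSpace ℂ P] : Prop :=
  ∃ f : ℍ → P, IsCoveringMap f ∧ Function.Surjective f ∧ MDifferentiable 𝓘(ℂ) 𝓘(ℂ) f

/-- The elements `x` and `y` are represented by simple contours which intersect in exactly one
point, the base point `p`.  In a holomorphic chart around `p` the contours are straight near `p`;
the directions of their ends (`x` arriving, `x` leaving, `y` arriving, `y` leaving) satisfy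
`R`. -/
def MeetOnce {p : P} (x y : FundamentalGroup P p) (R : ℂ → ℂ → ℂ → ℂ → Prop) : Prop :=
  ∃ (α β : Path p p) (φ : OpenPartialHomeomorph P ℂ) (xIn xOut yIn yOut : ℂ),
    IsSimpleContour α ∧ IsSimpleContour β ∧ contourClass α = x ∧ contourClass β = y ∧
    range α ∩ range β = {p} ∧
    φ ∈ IsManifold.maximalAtlas 𝓘(ℂ) ω P ∧ HasEnds φ α xOut xIn ∧ HasEnds φ β yOut yIn ∧
    R xIn xOut yIn yOut

/-- `x` and `y` are represented by simple contours intersecting in exactly one point `p`, with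
nonzero intersection number.  As `p` is the only common point, the intersection number is the
intersection index at `p`. -/
def IsCrossingPair {p : P} (x y : FundamentalGroup P p) : Prop :=
  MeetOnce x y fun xIn xOut yIn yOut => localIndex xIn xOut yIn yOut ≠ 0

/-- `x` and `y` are represented by simple contours intersecting in exactly one point `p`, whose
ends at `p` follow each other clockwise in the order: `x` leaving, `x` arriving, `y` leaving,
`y` arriving.  In particular their intersection number is zero. -/
def IsNegativePair {p : P} (x y : FundamentalGroup P p) : Prop :=
  MeetOnce x y fun xIn xOut yIn yOut => Clockwise [xOut, xIn, yOut, yIn]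

/-- An `m`-Arf function on `π₁⁰(P, p)`. -/
structure IsArf {p : P} {m : ℕ} (σ : simpleClasses P p → ZMod m) : Prop where
  conj : ∀ x y z : simpleClasses P p,
    (z : FundamentalGroup P p) = (y : FundamentalGroup P p) * x * (y : FundamentalGroup P p)⁻¹ →
      σ z = σ x
  inv : ∀ x z : simpleClasses P p,
    (z : FundamentalGroup P p) = (x : FundamentalGroup P p)⁻¹ → σ z = -σ x
  crossing : ∀ x y z : simpleClasses P p,
    (z : FundamentalGroup P p) = (x : FundamentalGroup P p) * y →
      IsCrossingPair (x : FundamentalGroup P p) y → σ z = σ x + σ y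
  negative : ∀ x y z : simpleClasses P p,
    (z : FundamentalGroup P p) = (x : FundamentalGroup P p) * y →
      IsNegativePair (x : FundamentalGroup P p) y → σ z = σ x + σ y - 1

/-! ### Standard bases -/

/-- Some connected component of the complement of `K` has boundary `range γ` and is
biholomorphic to the round annulus `{r < |z| < 1}`. -/
def BoundsAnnulus {p : P} (K : Set P) (γ : Path p p) (r : ℝ) : Prop :=
  ∃ f : ℂ → P, MDifferentiableOn 𝓘(ℂ) 𝓘(ℂ) f {z | r < ‖z‖ ∧ ‖z‖ < 1} ∧
    InjOn f {z | r < ‖z‖ ∧ ‖z‖ < 1} ∧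
    (∃ x ∈ Kᶜ, f '' {z | r < ‖z‖ ∧ ‖z‖ < 1} = connectedComponentIn Kᶜ x) ∧
    frontier (f '' {z | r < ‖z‖ ∧ ‖z‖ < 1}) = range γ

/-- The contour `γ` of a system of contours with union `K` encloses a puncture: it cuts off a
punctured disc. -/
def EnclosesPuncture {p : P} (K : Set P) (γ : Path p p) : Prop :=
  BoundsAnnulus K γ 0

/-- The contour `γ` of a system of contours with union `K` encloses a hole: it cuts off an annulus
of finite modulus. -/
def EnclosesHole {p : P} (K : Set P) (γ : Path p p) : Prop :=
  ∃ r : ℝ, 0 < r ∧ r < 1 ∧ BoundsAnnulus K γ r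

/-- The ends of the contours of a standard basis in their clockwise order around the base point:
for each `i` the ends `aᵢ` arriving, `bᵢ` leaving, `aᵢ` leaving, `bᵢ` arriving, and then for each
`j` the ends `cⱼ` arriving, `cⱼ` leaving. -/
def basisEnds {g n : ℕ} (out inn : Family ℂ g n) : List ℂ :=
  (List.ofFn fun i => [inn.a i, out.b i, out.a i, inn.b i]).flatten ++
    (List.ofFn fun j => [inn.c j, out.c j]).flatten

/-- A standard basis of `π₁(P, p)` for a surface `P` of genus `g` with `lh` holes and `lp`
punctures. -/
def IsStandardBasis {p : P} {g lh lp : ℕ} (v : Family (simpleClasses P p) g (lh + lp)) : Prop :=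
  (v.map Subtype.val).IsPresentation ∧
  ∃ κ : Family (Path p p) g (lh + lp),
    (∀ i, IsSimpleContour (κ.get i)) ∧
    (∀ i, contourClass (κ.get i) = v.get i) ∧
    (∀ i j, i ≠ j → range (κ.get i) ∩ range (κ.get j) = {p}) ∧
    (∀ j : Fin lh, EnclosesHole (⋃ i, range (κ.get i)) (κ.c (Fin.castAdd lp j))) ∧
    (∀ j : Fin lp, EnclosesPuncture (⋃ i, range (κ.get i)) (κ.c (Fin.natAdd lh j))) ∧
    ∃ (φ : OpenPartialHomeomorph P ℂ) (out inn : Family ℂ g (lh + lp)),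
      φ ∈ IsManifold.maximalAtlas 𝓘(ℂ) ω P ∧
      (∀ i, HasEnds φ (κ.get i) (out.get i) (inn.get i)) ∧
      Clockwise (basisEnds out inn)

end Surface

/-! ### Dehn twists -/

/-- The five types of Dehn twists for families with `g` pairs `a, b` and `n` elements `c`. -/
inductive DehnTwist (g n : ℕ) : Type
  | one (hg : 0 < g)
  | two (hg : 1 < g)
  | three (hg : 0 < g) (hn : 0 < n)
  | four (k : ℕ) (hk : k + 1 < g)
  | five (k : ℕ) (hk : k + 1 < n)

namespace DehnTwist

open Function

variable {g n : ℕ}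

/-- The transformation of bases given by a Dehn twist.  Members that are not mentioned do not
change. -/
def onBasis {G : Type*} [Group G] : DehnTwist g n → Family G g n → Family G g n
  | one hg, v =>
      { v with a := update v.a ⟨0, hg⟩ (v.a ⟨0, hg⟩ * v.b ⟨0, hg⟩) }
  | two hg, v =>
      let i₁ : Fin g := ⟨0, by omega⟩
      let i₂ : Fin g := ⟨1, hg⟩
      let a₁ := v.a i₁
      let b₁ := v.b i₁
      let a₂ := v.a i₂
      let b₂ := v.b i₂
      { v with
        a := update (update v.a i₁ ((a₁ * a₂) * a₁ * (a₁ * a₂)⁻¹)) i₂ (a₁ * a₂ * a₁⁻¹)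
        b := update (update v.b i₁ ((a₁ * a₂) * a₁⁻¹ * a₂⁻¹ * b₁ * (a₁ * a₂)⁻¹)) i₂
          (b₂ * a₂⁻¹ * a₁⁻¹) }
  | three hg hn, v =>
      let i : Fin g := ⟨g - 1, by omega⟩
      let j : Fin n := ⟨0, hn⟩
      let a := v.a i
      let b := v.b i
      let c := v.c j
      { a := update v.a i ((b⁻¹ * c) * b⁻¹ * (b⁻¹ * c)⁻¹)
        b := update v.b i ((b⁻¹ * c * b) * c⁻¹ * b * a * b⁻¹ * (b⁻¹ * c * b)⁻¹)
        c := update v.c j (b⁻¹ * c * b) }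
  | four k hk, v =>
      let i : Fin g := ⟨k, by omega⟩
      let i' : Fin g := ⟨k + 1, hk⟩
      let w := (groupComm (v.a i') (v.b i'))⁻¹ * groupComm (v.a i) (v.b i)
      { v with
        a := update (update v.a i (v.a i')) i' (w * v.a i * w⁻¹)
        b := update (update v.b i (v.b i')) i' (w * v.b i * w⁻¹) }
  | five k hk, v =>
      let j : Fin n := ⟨k, by omega⟩
      let j' : Fin n := ⟨k + 1, hk⟩
      { v with c := update (update v.c j (v.c j')) j' ((v.c j')⁻¹ * v.c j * v.c j') }

/-- The transformation of the values of an Arf function that corresponds to a Dehn twist.  Values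
that are not mentioned do not change. -/
def onValues {R : Type*} [Ring R] : DehnTwist g n → Family R g n → Family R g n
  | one hg, s =>
      { s with a := update s.a ⟨0, hg⟩ (s.a ⟨0, hg⟩ + s.b ⟨0, hg⟩) }
  | two hg, s =>
      let i₁ : Fin g := ⟨0, by omega⟩
      let i₂ : Fin g := ⟨1, hg⟩
      { s with
        b := update (update s.b i₁ (s.b i₁ - s.a i₁ - s.a i₂ - 1)) i₂
          (s.b i₂ - s.a i₂ - s.a i₁ - 1) }
  | three hg hn, s =>
      let i : Fin g := ⟨g - 1, by omega⟩
      let j : Fin n := ⟨0, hn⟩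
      { s with
        a := update s.a i (-s.b i)
        b := update s.b i (s.a i - s.c j - 1) }
  | four k hk, s =>
      let i : Fin g := ⟨k, by omega⟩
      let i' : Fin g := ⟨k + 1, hk⟩
      { s with
        a := update (update s.a i (s.a i')) i' (s.a i)
        b := update (update s.b i (s.b i')) i' (s.b i) }
  | five k hk, s =>
      let j : Fin n := ⟨k, by omega⟩
      let j' : Fin n := ⟨k + 1, hk⟩
      { s with c := update (update s.c j (s.c j')) j' (s.c j) }

end DehnTwist

end HigherArf

end

/-! The theorem reduces to identities in the fundamental group once two facts are known.

The first is that `σ` is invariant under conjugation by every element of the group, although axiom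
(i) only conjugates by simple classes. A conjugate of a simple class is again simple
(`mul_mul_inv_mem_simpleClasses`), because dragging the base point along a path is realised by
injective self-maps of the surface homotopic to the identity (`transportsSimple`). Hence axiom (i)
can be applied letter by letter to a word in the generators (`IsArf.conj_of_isStandardBasis`). This
settles every value on a member that a twist only permutes, inverts or conjugates.

The second is that `v'` is itself a standard basis, so that aᵢ' and bᵢ' cross once and `σ` is
additive on suitable products of them, and these products are conjugate to short words in `v`:
a₁'b₁' = a₁(b₁a₂⁻¹)a₁⁻¹ and b₂'a₂' = b₂a₁⁻¹ for twist 2, b'a'⁻¹ = c'(c⁻¹ba)c'⁻¹ for twist 3, where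
a, b have index g and c has index g+1. The short words are evaluated by axiom (iv), the source of
each summand -1 (`IsArf.b_mul_inv_a`, `IsArf.inv_c_mul_b_mul_a`). Solving for the value on b' gives
the formulas. Twist 1 is additivity for the crossing pair a₁, b₁.

The axioms apply only to products known to lie in π₁⁰. A simple representative comes from cutting a
corner at the base point (`exists_cut_corner`), nontriviality from a character to the integers
(`Family.IsPresentation.exists_character`). -/

noncomputable section

namespace HigherArf

/-! ### Moving a point inside a ball -/

/-- The map of the plane that moves `z₀` by `u` and fixes the complement of the ball of radius `ρ`
around `z₀`. -/
def bump (z₀ : ℂ) (ρ : ℝ) (u z : ℂ) : ℂ := z + max 0 (1 - ‖z - z₀‖ / ρ) • u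

lemma bump_center (z₀ : ℂ) (ρ : ℝ) (u : ℂ) : bump z₀ ρ u z₀ = z₀ + u := by
  simp [bump]

lemma bump_zero (z₀ : ℂ) (ρ : ℝ) (z : ℂ) : bump z₀ ρ 0 z = z := by
  simp [bump]

lemma bump_of_le {z₀ : ℂ} {ρ : ℝ} (hρ : 0 < ρ) {u z : ℂ} (h : ρ ≤ ‖z - z₀‖) :
    bump z₀ ρ u z = z := by
  have : 1 - ‖z - z₀‖ / ρ ≤ 0 := by
    rw [sub_nonpos, le_div_iff₀ hρ]; simpa using h
  simp [bump, max_eq_left this]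

lemma bump_mem_closedBall {z₀ : ℂ} {ρ : ℝ} (hρ : 0 < ρ) {u z : ℂ} (hu : ‖u‖ < ρ)
    (hz : ‖z - z₀‖ < ρ) : bump z₀ ρ u z ∈ Metric.closedBall z₀ ρ := by
  have h1 : 0 ≤ 1 - ‖z - z₀‖ / ρ := by
    rw [sub_nonneg, div_le_iff₀ hρ]; simpa using hz.le
  rw [mem_closedBall_iff_norm, bump, max_eq_right h1]
  calc ‖z + (1 - ‖z - z₀‖ / ρ) • u - z₀‖ = ‖(z - z₀) + (1 - ‖z - z₀‖ / ρ) • u‖ := by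
        congr 1; ring
    _ ≤ ‖z - z₀‖ + (1 - ‖z - z₀‖ / ρ) * ‖u‖ := by
        refine (norm_add_le _ _).trans ?_
        rw [norm_smul, Real.norm_of_nonneg h1]
    _ ≤ ‖z - z₀‖ + (1 - ‖z - z₀‖ / ρ) * ρ := by gcongr
    _ = ρ := by field_simp; ring

/-- The displacement is Lipschitz with constant `‖u‖ / ρ < 1`, so it cannot compensate for the
difference of two distinct points. -/
lemma bump_injective {z₀ : ℂ} {ρ : ℝ} (hρ : 0 < ρ) {u : ℂ} (hu : ‖u‖ < ρ) :
    Function.Injective (bump z₀ ρ u) := by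
  intro z w h
  by_contra hne
  have hpos : 0 < ‖z - w‖ := norm_pos_iff.2 (sub_ne_zero.2 hne)
  have h1 : z - w = (max 0 (1 - ‖w - z₀‖ / ρ) - max 0 (1 - ‖z - z₀‖ / ρ)) • u := by
    simp only [bump] at h
    rw [sub_smul]
    linear_combination h
  have h2 : |max 0 (1 - ‖w - z₀‖ / ρ) - max 0 (1 - ‖z - z₀‖ / ρ)| ≤ ‖z - w‖ / ρ := by
    rw [max_comm, max_comm (0 : ℝ)]
    refine (abs_max_sub_max_le_abs _ _ _).trans ?_
    have : 1 - ‖w - z₀‖ / ρ - (1 - ‖z - z₀‖ / ρ) = (‖z - z₀‖ - ‖w - z₀‖) / ρ := by ring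
    rw [this, abs_div, abs_of_pos hρ]
    gcongr
    simpa using abs_norm_sub_norm_le (z - z₀) (w - z₀)
  have h3 : ‖z - w‖ < ‖z - w‖ := by
    calc ‖z - w‖ = |max 0 (1 - ‖w - z₀‖ / ρ) - max 0 (1 - ‖z - z₀‖ / ρ)| * ‖u‖ := by
          conv_lhs => rw [h1, norm_smul, Real.norm_eq_abs]
      _ ≤ ‖z - w‖ / ρ * ‖u‖ := by gcongr
      _ < ‖z - w‖ / ρ * ρ := by gcongr
      _ = ‖z - w‖ := by field_simp
  exact lt_irrefl _ h3

lemma continuous_bump (z₀ : ℂ) (ρ : ℝ) : Continuous fun q : ℂ × ℂ => bump z₀ ρ q.1 q.2 := by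
  unfold bump; fun_prop

/-! ### Pushing points on the surface -/

section Push

variable {P : Type*} [TopologicalSpace P]

open Classical in
/-- The map of the surface that is `bump` in the chart `φ` and the identity elsewhere. -/
def push (φ : OpenPartialHomeomorph P ℂ) (z₀ : ℂ) (ρ : ℝ) (u : ℂ) (x : P) : P :=
  if x ∈ φ.source then φ.symm (bump z₀ ρ u (φ x)) else x

variable {φ : OpenPartialHomeomorph P ℂ} {z₀ : ℂ} {ρ : ℝ}

lemma bump_mem_target (hρ : 0 < ρ) (hφ : Metric.closedBall z₀ ρ ⊆ φ.target) {u z : ℂ}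
    (hu : ‖u‖ < ρ) (hz : z ∈ φ.target) : bump z₀ ρ u z ∈ φ.target := by
  rcases lt_or_ge ‖z - z₀‖ ρ with h | h
  · exact hφ (bump_mem_closedBall hρ hu h)
  · rwa [bump_of_le hρ h]

lemma push_injective (hρ : 0 < ρ) (hφ : Metric.closedBall z₀ ρ ⊆ φ.target) {u : ℂ}
    (hu : ‖u‖ < ρ) : Function.Injective (push φ z₀ ρ u) := by
  have key : ∀ x ∈ φ.source, φ.symm (bump z₀ ρ u (φ x)) ∈ φ.source := fun x hx =>
    φ.map_target (bump_mem_target hρ hφ hu (φ.map_source hx))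
  intro x y h
  by_cases hx : x ∈ φ.source <;> by_cases hy : y ∈ φ.source <;> simp only [push, hx, hy,
    if_true, if_false] at h
  · have h' := congrArg φ h
    rw [φ.right_inv (bump_mem_target hρ hφ hu (φ.map_source hx)),
      φ.right_inv (bump_mem_target hρ hφ hu (φ.map_source hy))] at h'
    exact φ.injOn hx hy (bump_injective hρ hu h')
  · exact absurd (h ▸ key x hx) hy
  · exact absurd (h ▸ key y hy) hx
  · exact h

lemma push_zero (φ : OpenPartialHomeomorph P ℂ) (z₀ : ℂ) (ρ : ℝ) (x : P) :
    push φ z₀ ρ 0 x = x := by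
  unfold push
  split_ifs with h
  · rw [bump_zero, φ.left_inv h]
  · rfl

/-- Scaling `u` by the time gives a homotopy from the identity. Continuity off the chart domain
holds because the moved points lie in the image of a closed disc, which is compact and therefore
closed in the Hausdorff space `P`. -/
lemma continuous_push [T2Space P] (hρ : 0 < ρ) (hφ : Metric.closedBall z₀ ρ ⊆ φ.target) {u : ℂ}
    (hu : ‖u‖ < ρ) :
    Continuous fun q : unitInterval × P => push φ z₀ ρ ((q.1 : ℝ) • u) q.2 := by
  have hu' : ∀ t : unitInterval, ‖(t : ℝ) • u‖ < ρ := fun t => by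
    rw [norm_smul, Real.norm_of_nonneg t.2.1]
    exact (mul_le_of_le_one_left (norm_nonneg _) t.2.2).trans_lt hu
  have hK : IsClosed (φ.symm '' Metric.closedBall z₀ ρ) :=
    ((isCompact_closedBall z₀ ρ).image_of_continuousOn (φ.continuousOn_symm.mono hφ)).isClosed
  rw [continuous_iff_continuousAt]
  rintro ⟨t, x⟩
  by_cases hx : x ∈ φ.source
  · have hev : (fun q : unitInterval × P => push φ z₀ ρ ((q.1 : ℝ) • u) q.2) =ᶠ[nhds (t, x)]
        fun q => φ.symm (bump z₀ ρ ((q.1 : ℝ) • u) (φ q.2)) := by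
      filter_upwards [continuous_snd.continuousAt.preimage_mem_nhds
        (φ.open_source.mem_nhds hx)] with q hq
      exact if_pos hq
    refine ContinuousAt.congr ?_ hev.symm
    have h1 : ContinuousAt (fun q : unitInterval × P => bump z₀ ρ ((q.1 : ℝ) • u) (φ q.2))
        (t, x) := by
      refine (continuous_bump z₀ ρ).continuousAt.comp
        (f := fun q : unitInterval × P => ((q.1 : ℝ) • u, φ q.2)) ?_
      refine ContinuousAt.prodMk (by fun_prop) ?_
      exact ContinuousAt.comp (f := Prod.snd) (φ.continuousAt hx) continuousAt_snd
    exact ContinuousAt.comp (f := fun q : unitInterval × P => bump z₀ ρ ((q.1 : ℝ) • u) (φ q.2))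
      (φ.continuousAt_symm (bump_mem_target hρ hφ (hu' t) (φ.map_source hx))) h1
  · have hxK : x ∉ φ.symm '' Metric.closedBall z₀ ρ := by
      rintro ⟨z, hz, rfl⟩
      exact hx (φ.map_target (hφ hz))
    have hev : (fun q : unitInterval × P => push φ z₀ ρ ((q.1 : ℝ) • u) q.2) =ᶠ[nhds (t, x)]
        Prod.snd := by
      filter_upwards [continuous_snd.continuousAt.preimage_mem_nhds
        (hK.isOpen_compl.mem_nhds hxK)] with q hq
      unfold push
      split_ifs with hs
      · rw [bump_of_le hρ, φ.left_inv hs]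
        by_contra! hlt
        exact hq ⟨φ q.2, mem_closedBall_iff_norm.2 hlt.le, φ.left_inv hs⟩
      · rfl
    exact continuousAt_snd.congr hev.symm

/-- Two paths with common ends in a convex part of a chart are homotopic. -/
lemma homotopic_of_mem_convex {x y : P} (φ : OpenPartialHomeomorph P ℂ) {C : Set ℂ}
    (hC : Convex ℝ C) (hCφ : C ⊆ φ.target) (γ δ : Path x y)
    (hγ : ∀ t, γ t ∈ φ.source ∧ φ (γ t) ∈ C) (hδ : ∀ t, δ t ∈ φ.source ∧ φ (δ t) ∈ C) :
    γ.Homotopic δ := by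
  have hγc : Continuous fun t => φ (γ t) :=
    φ.continuousOn.comp_continuous γ.continuous fun t => (hγ t).1
  have hδc : Continuous fun t => φ (δ t) :=
    φ.continuousOn.comp_continuous δ.continuous fun t => (hδ t).1
  have hmem : ∀ q : unitInterval × unitInterval,
      (1 - (q.1 : ℝ)) • φ (γ q.2) + (q.1 : ℝ) • φ (δ q.2) ∈ C := fun q =>
    hC (hγ _).2 (hδ _).2 (sub_nonneg.2 q.1.2.2) q.1.2.1 (by ring)
  have hγl : ∀ t, φ.symm (φ (γ t)) = γ t := fun t => φ.left_inv (hγ t).1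
  have hδl : ∀ t, φ.symm (φ (δ t)) = δ t := fun t => φ.left_inv (hδ t).1
  refine ⟨{ toFun := fun q => φ.symm ((1 - (q.1 : ℝ)) • φ (γ q.2) + (q.1 : ℝ) • φ (δ q.2))
            continuous_toFun := ?_
            map_zero_left := fun t => by simp [hγl]
            map_one_left := fun t => by simp [hδl]
            prop' := ?_ }⟩
  · refine φ.continuousOn_symm.comp_continuous ?_ fun q => hCφ (hmem q)
    have h0 : Continuous fun q : unitInterval × unitInterval => (q.1 : ℝ) :=
      continuous_subtype_val.comp continuous_fst
    exact ((continuous_const.sub h0).smul (hγc.comp continuous_snd)).add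
      (h0.smul (hδc.comp continuous_snd))
  · intro s t ht
    rcases ht with rfl | rfl
    · have := hγl 0
      simp only [Path.source] at this
      simp [← add_mul, this]
    · have := hγl 1
      simp only [Path.target] at this
      simp [← add_mul, this]

/-! ### Transport of simple contours along paths -/

/-- Simple contours at `y` can be carried back to `x` along the class of paths `q`. -/
def TransportsSimple {x y : P} (q : Path.Homotopic.Quotient x y) : Prop :=
  ∀ α : Path y y, IsSimpleContour α → ∃ β : Path x x, IsSimpleContour β ∧
    Path.Homotopic.Quotient.mk β = q.trans ((Path.Homotopic.Quotient.mk α).trans q.symm)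

lemma symm_trans_rev {x y z : P} (q : Path.Homotopic.Quotient x y)
    (r : Path.Homotopic.Quotient y z) : (q.trans r).symm = r.symm.trans q.symm := by
  induction q using Path.Homotopic.Quotient.ind with | _ q =>
  induction r using Path.Homotopic.Quotient.ind with | _ r =>
  simp only [← Path.Homotopic.Quotient.mk_symm, ← Path.Homotopic.Quotient.mk_trans,
    Path.trans_symm]

lemma TransportsSimple.trans {x y z : P} {q : Path.Homotopic.Quotient x y}
    {r : Path.Homotopic.Quotient y z} (hq : TransportsSimple q) (hr : TransportsSimple r) :
    TransportsSimple (q.trans r) := by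
  intro α hα
  obtain ⟨β, hβ, hβα⟩ := hr α hα
  obtain ⟨γ, hγ, hγβ⟩ := hq β hβ
  refine ⟨γ, hγ, ?_⟩
  rw [hγβ, hβα, symm_trans_rev]
  simp only [Path.Homotopic.Quotient.trans_assoc]

lemma IsSimpleContour.map {x : P} {α : Path x x} (hα : IsSimpleContour α) {f : P → P}
    (hf : Continuous f) (hinj : Function.Injective f) : IsSimpleContour (α.map hf) :=
  fun s t h => hα s t (hinj h)

/-- The image of a simple contour under an injective map is simple. By naturality of the homotopy, α
followed by the trace of `y` is homotopic to that trace followed by f ∘ α, and the trace is `γ`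
reversed. -/
lemma transportsSimple_of_homotopy {f : C(P, P)}
    (H : ContinuousMap.Homotopy (ContinuousMap.id P) f) (hf : Function.Injective f) {x y : P}
    (hxy : f y = x) {γ : Path x y} (hγ : (H.evalAt y).Homotopic (γ.symm.cast rfl hxy)) :
    TransportsSimple (Path.Homotopic.Quotient.mk γ) := by
  subst hxy
  intro α hα
  refine ⟨α.map f.continuous, hα.map _ hf, ?_⟩
  have h1 : (Path.Homotopic.Quotient.mk α).trans (Path.Homotopic.Quotient.mk γ).symm =
      (Path.Homotopic.Quotient.mk γ).symm.trans
        (Path.Homotopic.Quotient.mk (α.map f.continuous)) := by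
    have h2 := Path.Homotopic.Quotient.eq.2 (Path.Homotopic.map_trans_evalAt H α)
    rw [Path.Homotopic.Quotient.mk_trans, Path.Homotopic.Quotient.mk_trans,
      Path.Homotopic.Quotient.eq.2 hγ] at h2
    exact h2
  rw [h1, ← Path.Homotopic.Quotient.trans_assoc, Path.Homotopic.Quotient.trans_symm,
    Path.Homotopic.Quotient.refl_trans]

/-- Every point has a neighbourhood all of whose paths carry simple contours. -/
lemma exists_nhds_transportsSimple [T2Space P] [ChartedSpace ℂ P] (x₀ : P) :
    ∃ U : Set P, IsOpen U ∧ x₀ ∈ U ∧ ∀ {x y : P} (γ : Path x y), (∀ t, γ t ∈ U) →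
      TransportsSimple (Path.Homotopic.Quotient.mk γ) := by
  set φ := chartAt ℂ x₀
  have hx₀ : x₀ ∈ φ.source := mem_chart_source ℂ x₀
  obtain ⟨R, hR, hRφ⟩ := Metric.isOpen_iff.1 φ.open_target (φ x₀) (φ.map_source hx₀)
  refine ⟨φ.source ∩ φ ⁻¹' Metric.ball (φ x₀) (R / 3),
    φ.isOpen_inter_preimage Metric.isOpen_ball,
    ⟨hx₀, Metric.mem_ball_self (by positivity)⟩, ?_⟩
  intro x y γ hγ α hα
  have hx := hγ 0
  have hy := hγ 1
  simp only [Path.source, Path.target] at hx hy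
  -- Points of the disc of radius `R / 3` are less than `2R/3` apart, and a disc of radius `2R/3`
  -- around any of them stays inside the disc of radius `R` in the chart.
  have hρ : 0 < 2 * R / 3 := by positivity
  set u : ℂ := φ x - φ y
  have hu : ‖u‖ < 2 * R / 3 := by
    rw [← dist_eq_norm]
    have h1 := Metric.mem_ball.1 hx.2
    have h2 := Metric.mem_ball'.1 hy.2
    linarith [dist_triangle (φ x) (φ x₀) (φ y)]
  have hball : Metric.closedBall (φ y) (2 * R / 3) ⊆ φ.target := by
    refine Subset.trans (fun z hz => ?_) hRφ
    have h1 := Metric.mem_ball.1 hy.2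
    have h2 := Metric.mem_closedBall.1 hz
    rw [Metric.mem_ball]
    linarith [dist_triangle z (φ y) (φ x₀)]
  have hcont := continuous_push hρ hball hu
  have hy1 : push φ (φ y) (2 * R / 3) u y = x := by
    simp [push, hy.1, bump_center, u, φ.left_inv hx.1]
  let f : C(P, P) := ⟨push φ (φ y) (2 * R / 3) u, by
    have := hcont.comp (Continuous.prodMk_right (1 : unitInterval))
    simpa [Function.comp_def] using this⟩
  let H : ContinuousMap.Homotopy (ContinuousMap.id P) f :=
    { toFun := fun q => push φ (φ y) (2 * R / 3) ((q.1 : ℝ) • u) q.2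
      continuous_toFun := hcont
      map_zero_left := fun z => by simp [push_zero]
      map_one_left := fun z => by simp [f] }
  refine transportsSimple_of_homotopy H (push_injective hρ hball hu) hy1 ?_ α hα
  refine homotopic_of_mem_convex φ (convex_ball (φ x₀) (R / 3))
    ((Metric.ball_subset_ball (by linarith)).trans hRφ) _ _ (fun t => ?_) fun t => hγ _
  have ht : H.evalAt y t = φ.symm (φ y + (t : ℝ) • u) := by
    change push φ (φ y) (2 * R / 3) ((t : ℝ) • u) y = _
    simp [push, hy.1, bump_center]
  have hmem : φ y + (t : ℝ) • u ∈ Metric.ball (φ x₀) (R / 3) :=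
    (convex_ball (φ x₀) (R / 3)).add_smul_sub_mem hy.2 hx.2 t.2
  have htar : φ y + (t : ℝ) • u ∈ φ.target :=
    hRφ (Metric.ball_subset_ball (by linarith) hmem)
  rw [ht, φ.right_inv htar]
  exact ⟨φ.map_target htar, hmem⟩

/-- Every path carries simple contours. -/
lemma transportsSimple [T2Space P] [ChartedSpace ℂ P] {x y : P}
    (q : Path.Homotopic.Quotient x y) : TransportsSimple q := by
  induction q using Path.Homotopic.Quotient.ind with | _ γ =>
  choose U hUo hU hUt using exists_nhds_transportsSimple (P := P)
  obtain ⟨t, ht0, hmono, ⟨n, hn⟩, ht⟩ := exists_monotone_Icc_subset_open_cover_unitInterval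
    (c := fun x => γ ⁻¹' U x) (fun x => (hUo x).preimage γ.continuous)
    fun s _ => mem_iUnion.2 ⟨γ s, hU _⟩
  -- The path is subdivided into pieces that each stay in one good neighbourhood, and the transports
  -- along the pieces are composed.
  have key : ∀ k, TransportsSimple (Path.Homotopic.Quotient.mk (γ.subpath 0 (t k))) := by
    intro k
    induction k with
    | zero =>
      rw [ht0]
      refine hUt (γ 0) _ fun s => ?_
      rw [Path.subpath_self]
      exact hU _
    | succ k ih =>
      obtain ⟨i, hi⟩ := ht k
      have h : TransportsSimple (Path.Homotopic.Quotient.mk (γ.subpath (t k) (t (k + 1)))) := by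
        refine hUt i _ fun s => hi ?_
        have hle := hmono k.le_succ
        exact ⟨Icc.le_convexComb hle s, Icc.convexComb_le hle s⟩
      have h' := ih.trans h
      rwa [← Path.Homotopic.Quotient.mk_trans, Path.Homotopic.Quotient.eq.2
        ⟨Path.Homotopy.subpathTransSubpath γ 0 (t k) (t (k + 1))⟩] at h'
  have h1 := key n
  rw [hn n le_rfl, Path.subpath_zero_one] at h1
  have hcast : ∀ {x' y' : P} (hx : x' = x) (hy : y' = y),
      TransportsSimple (Path.Homotopic.Quotient.mk (γ.cast hx hy)) →
      TransportsSimple (Path.Homotopic.Quotient.mk γ) := by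
    rintro _ _ rfl rfl h
    exact h
  exact hcast _ _ h1

lemma mul_mul_inv_mem_simpleClasses [T2Space P] [ChartedSpace ℂ P] {p : P}
    {x : FundamentalGroup P p} (hx : x ∈ simpleClasses P p) (y : FundamentalGroup P p) :
    y * x * y⁻¹ ∈ simpleClasses P p := by
  obtain ⟨hx1, α, hα, rfl⟩ := hx
  refine ⟨fun h => hx1 (conj_eq_one_iff.1 h), ?_⟩
  -- Transport runs through the path, then `α`, then the path backwards. As products are read from
  -- right to left, the path has to be `y⁻¹`.
  obtain ⟨β, hβ, hβα⟩ := transportsSimple (P := P) (y⁻¹ : FundamentalGroup P p) α hα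
  refine ⟨β, hβ, ?_⟩
  have h : contourClass β = y⁻¹⁻¹ * contourClass α * y⁻¹ := by
    exact hβα
  rwa [inv_inv] at h

end Push

/-! ### Directions -/

/-- The nonzero vector `z` has argument `θ`. -/
def HasArg (z : ℂ) (θ : ℝ) : Prop := ∃ ρ : ℝ, 0 < ρ ∧ z = ρ * Complex.exp (θ * Complex.I)

lemma norm_mul_exp {ρ : ℝ} (hρ : 0 < ρ) (θ : ℝ) : ‖ρ * Complex.exp (θ * Complex.I)‖ = ρ := by
  rw [norm_mul, Complex.norm_exp_ofReal_mul_I, mul_one, Complex.norm_of_nonneg hρ.le]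

lemma HasArg.ne_zero {z : ℂ} {θ : ℝ} (h : HasArg z θ) : z ≠ 0 := by
  obtain ⟨ρ, hρ, rfl⟩ := h
  rw [← norm_pos_iff, norm_mul_exp hρ]
  exact hρ

lemma HasArg.eq_norm_mul {z : ℂ} {θ : ℝ} (h : HasArg z θ) :
    z = ‖z‖ * Complex.exp (θ * Complex.I) := by
  obtain ⟨ρ, hρ, rfl⟩ := h
  rw [norm_mul_exp hρ]

lemma HasArg.smul {z : ℂ} {θ c : ℝ} (h : HasArg z θ) (hc : 0 < c) : HasArg (c • z) θ := by
  obtain ⟨ρ, hρ, rfl⟩ := h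
  exact ⟨c * ρ, by positivity, by simp [mul_assoc]⟩

lemma hasArg_smul_iff {z : ℂ} {θ c : ℝ} (hc : 0 < c) : HasArg (c • z) θ ↔ HasArg z θ := by
  refine ⟨fun h => ?_, fun h => h.smul hc⟩
  have := h.smul (inv_pos.2 hc)
  rwa [smul_smul, inv_mul_cancel₀ hc.ne', one_smul] at this

/-- Two arguments of the same vector differ by at least `2π`. -/
lemma HasArg.unique {z : ℂ} {θ θ' : ℝ} (h : HasArg z θ) (h' : HasArg z θ')
    (hlt : |θ - θ'| < 2 * Real.pi) : θ = θ' := by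
  have hz : (‖z‖ : ℂ) ≠ 0 := by simpa using h.ne_zero
  have he : Complex.exp (θ * Complex.I) = Complex.exp (θ' * Complex.I) :=
    mul_left_cancel₀ hz (h.eq_norm_mul.symm.trans h'.eq_norm_mul)
  obtain ⟨n, hn⟩ := Complex.exp_eq_exp_iff_exists_int.1 he
  have hn' : θ = θ' + n * (2 * Real.pi) := by
    have h2 : (θ : ℂ) = θ' + n * (2 * Real.pi) :=
      mul_right_cancel₀ Complex.I_ne_zero (by linear_combination hn)
    exact_mod_cast h2
  have hn0 : |(n : ℝ)| < 1 := by
    have hpi := Real.pi_pos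
    rw [hn', add_sub_cancel_left, abs_mul, abs_of_pos (by positivity : 0 < 2 * Real.pi)] at hlt
    exact (mul_lt_iff_lt_one_left (by positivity)).1 hlt
  have : n = 0 := by
    rw [← Int.cast_abs] at hn0
    exact Int.abs_lt_one_iff.1 (by exact_mod_cast hn0)
  simpa [this] using hn'

/-- Angles that decrease by less than `2π` altogether. -/
def TurnsClockwise (l : List ℝ) : Prop :=
  l.Pairwise fun θ θ' => θ' < θ ∧ θ - θ' < 2 * Real.pi

/-- A list of angles with a pairwise condition passes to sublists, which the function on `Fin
l.length` does not do directly. -/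
lemma clockwise_iff {l : List ℂ} :
    Clockwise l ↔ ∃ L : List ℝ, TurnsClockwise L ∧ List.Forall₂ HasArg l L := by
  constructor
  · rintro ⟨θ, hθ, hlt, h⟩
    refine ⟨List.ofFn θ, List.pairwise_ofFn.2 fun i j hij => ⟨hθ hij, hlt i j⟩, ?_⟩
    rw [List.forall₂_iff_get]
    refine ⟨by simp, fun i h₁ h₂ => ?_⟩
    simpa [HasArg] using h ⟨i, h₁⟩
  · rintro ⟨L, hL, h⟩
    rw [List.forall₂_iff_get] at h
    obtain ⟨hlen, h⟩ := h
    rw [TurnsClockwise, List.pairwise_iff_get] at hL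
    have hpi := Real.pi_pos
    refine ⟨fun i => L.get (i.cast hlen), fun i j hij => (hL _ _ (by simpa using hij)).1,
      fun i j => ?_, fun i => h i i.2 (by omega)⟩
    rcases lt_trichotomy i j with hij | rfl | hij
    · exact (hL _ _ (by simpa using hij)).2
    · simpa using hpi
    · have := (hL (j.cast hlen) (i.cast hlen) (by simpa using hij)).1
      linarith

lemma Clockwise.sublist {l l' : List ℂ} (h : Clockwise l) (hl : l'.Sublist l) : Clockwise l' := by
  rw [clockwise_iff] at *
  obtain ⟨L, hL, h⟩ := h
  suffices ∃ L', L'.Sublist L ∧ List.Forall₂ HasArg l' L' by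
    obtain ⟨L', hs, h'⟩ := this
    exact ⟨L', hL.sublist hs, h'⟩
  clear hL
  induction hl generalizing L with
  | slnil => exact ⟨[], by simp, by simp⟩
  | cons a _ ih =>
    cases h with
    | cons h₁ h₂ =>
      obtain ⟨L', hs, h'⟩ := ih _ h₂
      exact ⟨L', hs.cons _, h'⟩
  | cons_cons a _ ih =>
    cases h with
    | cons h₁ h₂ =>
      obtain ⟨L', hs, h'⟩ := ih _ h₂
      exact ⟨_, hs.cons_cons _, .cons h₁ h'⟩

lemma clockwise_four {z₁ z₂ z₃ z₄ : ℂ} : Clockwise [z₁, z₂, z₃, z₄] ↔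
    ∃ θ₁ θ₂ θ₃ θ₄ : ℝ, (θ₂ < θ₁ ∧ θ₃ < θ₂ ∧ θ₄ < θ₃ ∧ θ₁ - θ₄ < 2 * Real.pi) ∧
      HasArg z₁ θ₁ ∧ HasArg z₂ θ₂ ∧ HasArg z₃ θ₃ ∧ HasArg z₄ θ₄ := by
  rw [clockwise_iff]
  constructor
  · rintro ⟨L, hL, h⟩
    simp only [List.forall₂_cons_left_iff, List.forall₂_nil_left_iff] at h
    obtain ⟨θ₁, _, h₁, ⟨θ₂, _, h₂, ⟨θ₃, _, h₃, ⟨θ₄, _, h₄, rfl, rfl⟩, rfl⟩, rfl⟩, rfl⟩ := h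
    simp only [TurnsClockwise, List.pairwise_cons, List.mem_cons, List.not_mem_nil] at hL
    exact ⟨θ₁, θ₂, θ₃, θ₄, by simp_all, h₁, h₂, h₃, h₄⟩
  · rintro ⟨θ₁, θ₂, θ₃, θ₄, ⟨h12, h23, h34, h14⟩, h₁, h₂, h₃, h₄⟩
    refine ⟨[θ₁, θ₂, θ₃, θ₄], ?_, by simp [h₁, h₂, h₃, h₄]⟩
    simp only [TurnsClockwise, List.pairwise_cons, List.mem_cons, List.not_mem_nil]
    simp only [or_false, forall_eq_or_imp, forall_eq, IsEmpty.forall_iff, implies_true,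
      List.Pairwise.nil, and_true]
    refine ⟨⟨⟨?_, ?_⟩, ⟨?_, ?_⟩, ?_, ?_⟩, ⟨⟨?_, ?_⟩, ?_, ?_⟩, ?_, ?_⟩ <;> linarith

lemma HasArg.add_two_pi {z : ℂ} {θ : ℝ} (h : HasArg z θ) : HasArg z (θ + 2 * Real.pi) := by
  obtain ⟨ρ, hρ, rfl⟩ := h
  refine ⟨ρ, hρ, ?_⟩
  push_cast
  rw [add_mul, Complex.exp_periodic]

/-- The order is cyclic: the last angle plus 2π exceeds the first one. -/
lemma Clockwise.rotate {z₁ z₂ z₃ z₄ : ℂ} (h : Clockwise [z₁, z₂, z₃, z₄]) :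
    Clockwise [z₄, z₁, z₂, z₃] := by
  rw [clockwise_four] at *
  obtain ⟨θ₁, θ₂, θ₃, θ₄, ⟨h12, h23, h34, h14⟩, h₁, h₂, h₃, h₄⟩ := h
  exact ⟨θ₄ + 2 * Real.pi, θ₁, θ₂, θ₃, ⟨by linarith, by linarith, by linarith, by linarith⟩,
    h₄.add_two_pi, h₁, h₂, h₃⟩

lemma Clockwise.smul {z₁ z₂ z₃ z₄ : ℂ} (h : Clockwise [z₁, z₂, z₃, z₄]) {c₁ c₂ c₃ c₄ : ℝ}
    (h₁ : 0 < c₁) (h₂ : 0 < c₂) (h₃ : 0 < c₃) (h₄ : 0 < c₄) :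
    Clockwise [c₁ • z₁, c₂ • z₂, c₃ • z₃, c₄ • z₄] := by
  rw [clockwise_four] at *
  simpa only [hasArg_smul_iff h₁, hasArg_smul_iff h₂, hasArg_smul_iff h₃, hasArg_smul_iff h₄]
    using h

/-! ### Concatenation of simple arcs -/

section Arcs

variable {P : Type*} [TopologicalSpace P]

lemma trans_injective {x y z : P} {γ : Path x y} {δ : Path y z} (hγ : Function.Injective γ)
    (hδ : Function.Injective δ) (h : range γ ∩ range δ ⊆ {y}) :
    Function.Injective (γ.trans δ) := by
  have key : ∀ s t : unitInterval, (s : ℝ) ≤ 1 / 2 → ¬ (t : ℝ) ≤ 1 / 2 →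
      γ.trans δ s ≠ γ.trans δ t := by
    intro s t hs ht hst
    simp only [Path.trans_apply, hs, ht, dif_pos, dif_neg, not_false_eq_true] at hst
    have h2 := h ⟨⟨_, hst⟩, ⟨_, rfl⟩⟩
    have h3 := congrArg Subtype.val (hδ (h2.trans δ.source.symm))
    simp only [Set.Icc.coe_zero] at h3
    linarith
  intro s t hst
  by_cases hs : (s : ℝ) ≤ 1 / 2 <;> by_cases ht : (t : ℝ) ≤ 1 / 2
  · simp only [Path.trans_apply, hs, ht, dif_pos] at hst
    have h3 := congrArg Subtype.val (hγ hst)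
    simp only at h3
    exact Subtype.ext (by linarith)
  · exact absurd hst (key s t hs ht)
  · exact absurd hst.symm (key t s ht hs)
  · simp only [Path.trans_apply, hs, ht, dif_neg, not_false_eq_true] at hst
    have h3 := congrArg Subtype.val (hδ hst)
    simp only at h3
    exact Subtype.ext (by linarith)

lemma isSimpleContour_trans {x y : P} {γ : Path x y} {δ : Path y x} (hγ : Function.Injective γ)
    (hδ : Function.Injective δ) (h : range γ ∩ range δ ⊆ {x, y}) :
    IsSimpleContour (γ.trans δ) := by
  have key : ∀ s t : unitInterval, (s : ℝ) ≤ 1 / 2 → ¬ (t : ℝ) ≤ 1 / 2 →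
      γ.trans δ s = γ.trans δ t → s = 0 ∧ t = 1 := by
    intro s t hs ht hst
    simp only [Path.trans_apply, hs, ht, dif_pos, dif_neg, not_false_eq_true] at hst
    rcases h ⟨⟨_, hst⟩, ⟨_, rfl⟩⟩ with h2 | h2
    · have h3 := congrArg Subtype.val (hγ ((hst.trans h2).trans γ.source.symm))
      have h5 := congrArg Subtype.val (hδ (h2.trans δ.target.symm))
      simp only [Set.Icc.coe_zero, Set.Icc.coe_one] at h3 h5
      exact ⟨Subtype.ext (by rw [Set.Icc.coe_zero]; linarith),
        Subtype.ext (by rw [Set.Icc.coe_one]; linarith)⟩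
    · have h3 := congrArg Subtype.val (hδ (Eq.trans h2 δ.source.symm))
      simp only [Set.Icc.coe_zero] at h3
      linarith
  intro s t hst
  by_cases hs : (s : ℝ) ≤ 1 / 2 <;> by_cases ht : (t : ℝ) ≤ 1 / 2
  · simp only [Path.trans_apply, hs, ht, dif_pos] at hst
    have h3 := congrArg Subtype.val (hγ hst)
    simp only at h3
    exact .inl (Subtype.ext (by linarith))
  · exact .inr (.inl (key s t hs ht hst))
  · exact .inr (.inr (key t s ht hs hst.symm).symm)
  · simp only [Path.trans_apply, hs, ht, dif_neg, not_false_eq_true] at hst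
    have h3 := congrArg Subtype.val (hδ hst)
    simp only at h3
    exact .inl (Subtype.ext (by linarith))

/-- The part of a path before `τ`. -/
def initialPart {x y : P} (γ : Path x y) (τ : unitInterval) : Path x (γ τ) :=
  (γ.subpath 0 τ).cast γ.source.symm rfl

/-- The part of a path after `τ`. -/
def finalPart {x y : P} (γ : Path x y) (τ : unitInterval) : Path (γ τ) y :=
  (γ.subpath τ 1).cast rfl γ.target.symm

lemma homotopic_initialPart_trans_finalPart {x y : P} (γ : Path x y) (τ : unitInterval) :
    ((initialPart γ τ).trans (finalPart γ τ)).Homotopic γ := by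
  have h : ((γ.subpath 0 τ).trans (γ.subpath τ 1)).Homotopic (γ.subpath 0 1) :=
    ⟨Path.Homotopy.subpathTransSubpath γ 0 τ 1⟩
  have h' := h.pathCast γ.source.symm γ.target.symm
  rw [Path.subpath_zero_one] at h'
  exact h'

lemma initialPart_apply {x y : P} (γ : Path x y) (τ t : unitInterval) :
    initialPart γ τ t = γ (τ * t) := by
  change γ (Icc.convexComb 0 τ t) = _
  congr 1
  exact Subtype.ext (by simp [mul_comm])

lemma finalPart_apply {x y : P} (γ : Path x y) (τ t : unitInterval) :
    finalPart γ τ t = γ (Icc.convexComb τ 1 t) := rfl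

lemma initialPart_injective {x : P} {γ : Path x x} (hγ : IsSimpleContour γ) {τ : unitInterval}
    (h0 : (0 : ℝ) < τ) (h1 : (τ : ℝ) < 1) : Function.Injective (initialPart γ τ) := by
  intro s t h
  rw [initialPart_apply, initialPart_apply] at h
  have hlt : ∀ s : unitInterval, τ * s ≠ 1 := fun s hs => by
    have := congrArg Subtype.val hs
    simp only [Set.Icc.coe_mul, Set.Icc.coe_one] at this
    nlinarith [s.2.1, s.2.2]
  rcases hγ _ _ h with h | ⟨-, h⟩ | ⟨h, -⟩
  · have := congrArg Subtype.val h
    simp only [Set.Icc.coe_mul] at this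
    exact Subtype.ext (mul_left_cancel₀ h0.ne' this)
  · exact absurd h (hlt _)
  · exact absurd h (hlt _)

lemma finalPart_injective {x : P} {γ : Path x x} (hγ : IsSimpleContour γ) {τ : unitInterval}
    (h0 : (0 : ℝ) < τ) (h1 : (τ : ℝ) < 1) : Function.Injective (finalPart γ τ) := by
  intro s t h
  rw [finalPart_apply, finalPart_apply] at h
  have hlt : ∀ s : unitInterval, Icc.convexComb τ 1 s ≠ 0 := fun s hs => by
    have := congrArg Subtype.val hs
    simp only [Icc.coe_convexComb, Set.Icc.coe_one, Set.Icc.coe_zero] at this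
    nlinarith [s.2.1, s.2.2]
  rcases hγ _ _ h with h | ⟨h, -⟩ | ⟨-, h⟩
  · have := congrArg Subtype.val h
    simp only [Icc.coe_convexComb, Set.Icc.coe_one] at this
    have h2 : (1 - (τ : ℝ)) * s = (1 - τ) * t := by linarith
    exact Subtype.ext (mul_left_cancel₀ (by linarith) h2)
  · exact absurd h (hlt _)
  · exact absurd h (hlt _)

lemma range_initialPart_subset {x y : P} (γ : Path x y) (τ : unitInterval) :
    range (initialPart γ τ) ⊆ range γ := by
  rintro _ ⟨t, rfl⟩
  exact ⟨_, rfl⟩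

lemma range_finalPart_subset {x y : P} (γ : Path x y) (τ : unitInterval) :
    range (finalPart γ τ) ⊆ range γ := by
  rintro _ ⟨t, rfl⟩
  exact ⟨_, rfl⟩

end Arcs

section Corners

variable {P : Type*} [TopologicalSpace P]

/-! ### Contours near the base point -/

section Ends

variable {p : P} {φ : OpenPartialHomeomorph P ℂ} {α : Path p p} {out inn : ℂ}

lemma HasEnds.mem_source (h : HasEnds φ α out inn) : p ∈ φ.source := by
  obtain ⟨ε, hε, h⟩ := h
  have := (h 0 hε.le).1.1
  rwa [α.source] at this

lemma HasEnds.map_eq_zero (h : HasEnds φ α out inn) : φ p = 0 := by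
  obtain ⟨ε, hε, h⟩ := h
  have := (h 0 hε.le).1.2
  rw [α.source] at this
  simpa using this

lemma HasEnds.zero_mem_target (h : HasEnds φ α out inn) : (0 : ℂ) ∈ φ.target :=
  h.map_eq_zero ▸ φ.map_source h.mem_source

lemma HasEnds.symm (h : HasEnds φ α out inn) : HasEnds φ α.symm inn out := by
  obtain ⟨ε, hε, h⟩ := h
  refine ⟨ε, hε, fun t ht => ?_⟩
  obtain ⟨h₁, h₂⟩ := h t ht
  exact ⟨h₂, by simpa using h₁⟩

lemma IsSimpleContour.symm (h : IsSimpleContour α) : IsSimpleContour α.symm := by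
  intro s t hst
  rcases h _ _ hst with h | ⟨h, h'⟩ | ⟨h, h'⟩
  · exact .inl (unitInterval.symm_bijective.injective h)
  · right; right
    exact ⟨by simpa using congrArg unitInterval.symm h, by simpa using congrArg unitInterval.symm h'⟩
  · right; left
    exact ⟨by simpa using congrArg unitInterval.symm h, by simpa using congrArg unitInterval.symm h'⟩

lemma contourClass_symm (α : Path p p) : contourClass α.symm = (contourClass α)⁻¹ := rfl

/-- In a small disc around the base point a simple contour consists of its two ends. -/
lemma HasEnds.exists_radius [T2Space P] (h : HasEnds φ α out inn) (hα : IsSimpleContour α) :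
    ∃ r : ℝ, 0 < r ∧ Metric.ball 0 r ⊆ φ.target ∧ ∀ (t : unitInterval) (z : ℂ), ‖z‖ < r →
      φ.symm z = α t → z = (t : ℝ) • out ∨ z = (1 - (t : ℝ)) • inn := by
  have hp := h.mem_source
  have hp0 := h.map_eq_zero
  have h0 := h.zero_mem_target
  obtain ⟨ε, hε, h⟩ := h
  -- The middle part of the contour is compact and misses `p`, so a small disc around `p` avoids it.
  set K : Set P := α '' {t : unitInterval | ε ≤ t ∧ ε ≤ 1 - (t : ℝ)}
  have hK : IsClosed K := by
    refine (IsCompact.image (IsClosed.isCompact ?_) α.continuous).isClosed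
    exact (isClosed_le continuous_const continuous_subtype_val).inter
      (isClosed_le continuous_const (continuous_const.sub continuous_subtype_val))
  have hpK : p ∉ K := by
    rintro ⟨t, ⟨ht, ht'⟩, htp⟩
    rcases hα t 0 (htp.trans α.source.symm) with rfl | ⟨rfl, -⟩ | ⟨rfl, -⟩
    · simp at ht; linarith
    · simp at ht; linarith
    · simp at ht'; linarith
  have hsymm : φ.symm 0 = p := by rw [← hp0, φ.left_inv hp]
  have hnhds : φ.target ∩ φ.symm ⁻¹' Kᶜ ∈ nhds (0 : ℂ) :=
    Filter.inter_mem (φ.open_target.mem_nhds h0) ((φ.continuousAt_symm h0).preimage_mem_nhds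
      (hK.isOpen_compl.mem_nhds (by rwa [hsymm])))
  obtain ⟨r, hr, hball⟩ := Metric.mem_nhds_iff.1 hnhds
  refine ⟨r, hr, fun z hz => (hball hz).1, fun t z hz htz => ?_⟩
  have hz' := hball (mem_ball_zero_iff.2 hz)
  have hφ : φ (α t) = z := by rw [← htz, φ.right_inv hz'.1]
  by_cases ht : (t : ℝ) ≤ ε
  · exact .inl (hφ.symm.trans (h t ht).1.2)
  by_cases ht' : 1 - (t : ℝ) ≤ ε
  · right
    have := (h (unitInterval.symm t) ht').2.2
    rw [unitInterval.symm_symm, hφ] at this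
    exact this
  · exact absurd ⟨t, ⟨(not_le.1 ht).le, (not_le.1 ht').le⟩, htz.symm⟩ hz'.2

/-- The point of argument `θ` on the circle of radius `r`. -/
def circlePoint (r θ : ℝ) : ℂ := r * Complex.exp (θ * Complex.I)

lemma norm_circlePoint {r : ℝ} (hr : 0 < r) (θ : ℝ) : ‖circlePoint r θ‖ = r := norm_mul_exp hr θ

lemma hasArg_circlePoint {r : ℝ} (hr : 0 < r) (θ : ℝ) : HasArg (circlePoint r θ) θ := ⟨r, hr, rfl⟩

lemma continuous_circlePoint (r : ℝ) : Continuous (circlePoint r) := by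
  unfold circlePoint; fun_prop

lemma HasArg.smul_eq_circlePoint {z : ℂ} {θ r : ℝ} (h : HasArg z θ) :
    (r / ‖z‖) • z = circlePoint r θ := by
  have hz : (‖z‖ : ℂ) ≠ 0 := by simpa using h.ne_zero
  rw [circlePoint, Complex.real_smul]
  push_cast
  field_simp
  rw [mul_assoc, ← h.eq_norm_mul]

lemma HasArg.of_smul_nonneg {z : ℂ} {θ c : ℝ} (hc : 0 ≤ c) (h : HasArg (c • z) θ) :
    HasArg z θ := by
  rcases hc.eq_or_lt with rfl | hc
  · exact absurd (zero_smul ℝ z) h.ne_zero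
  · exact (hasArg_smul_iff hc).1 h

/-- A small circle meets a simple contour only in the directions of the ends. -/
lemma HasEnds.exists_radius_hasArg [T2Space P] (h : HasEnds φ α out inn)
    (hα : IsSimpleContour α) : ∃ r₀ : ℝ, 0 < r₀ ∧ Metric.ball 0 r₀ ⊆ φ.target ∧
      ∀ r θ : ℝ, 0 < r → r < r₀ → φ.symm (circlePoint r θ) ∈ range α →
        HasArg out θ ∨ HasArg inn θ := by
  obtain ⟨r₀, hr₀, hball, H⟩ := h.exists_radius hα
  refine ⟨r₀, hr₀, hball, fun r θ hr hlt => ?_⟩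
  rintro ⟨t, ht⟩
  rcases H t _ (by rwa [norm_circlePoint hr]) ht.symm with h | h
  · exact .inl (.of_smul_nonneg t.2.1 (h ▸ hasArg_circlePoint hr θ))
  · exact .inr (.of_smul_nonneg (sub_nonneg.2 t.2.2) (h ▸ hasArg_circlePoint hr θ))

end Ends

/-! ### Cutting a corner -/

/-- Let the contour `β` arrive and the contour `α` leave in directions that bound a sector free of
the other ends.  Then `β` followed by `α` is homotopic to a simple contour, which replaces the
corner by an arc of a small circle. -/
lemma exists_cut_corner [T2Space P] {p : P} {φ : OpenPartialHomeomorph P ℂ} {α β : Path p p}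
    {αOut αIn βOut βIn : ℂ} (hα : IsSimpleContour α) (hβ : IsSimpleContour β)
    (hαβ : range α ∩ range β = {p}) (eα : HasEnds φ α αOut αIn) (eβ : HasEnds φ β βOut βIn)
    {θ₀ θ₁ : ℝ} (h01 : θ₁ < θ₀) (h2π : θ₀ - θ₁ < 2 * Real.pi)
    (h₀ : HasArg βIn θ₀) (h₁ : HasArg αOut θ₁)
    (hfree : ∀ θ ∈ Icc θ₁ θ₀, ¬ HasArg αIn θ ∧ ¬ HasArg βOut θ) :
    ∃ r₀ : ℝ, 0 < r₀ ∧ ∀ r : ℝ, 0 < r → r < r₀ → ∃ δ : Path p p, IsSimpleContour δ ∧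
      contourClass δ = contourClass α * contourClass β ∧
      (∃ k k' : ℝ, 0 < k ∧ 0 < k' ∧ HasEnds φ δ (k • βOut) (k' • αIn)) ∧
      range δ ⊆ range α ∪ range β ∪ (fun θ => φ.symm (circlePoint r θ)) '' Icc θ₁ θ₀ := by
  obtain ⟨rα, hrα, hballα, Hα⟩ := eα.exists_radius_hasArg hα
  obtain ⟨rβ, hrβ, -, Hβ⟩ := eβ.exists_radius_hasArg hβ
  obtain ⟨εα, hεα, Eα⟩ := id eα
  obtain ⟨εβ, hεβ, Eβ⟩ := id eβ
  have hαn : 0 < ‖αOut‖ := norm_pos_iff.2 h₁.ne_zero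
  have hβn : 0 < ‖βIn‖ := norm_pos_iff.2 h₀.ne_zero
  -- The first two bounds make the circle meet the contours only in the directions of their ends.
  -- The others make it cut the straight ends of `α` and `β` while they are still straight, less
  -- than half a unit of time from `p`.
  refine ⟨min (min rα rβ) (min (min εα (1 / 2) * ‖αOut‖) (min εβ (1 / 2) * ‖βIn‖)),
    by positivity, fun r hr hlt => ?_⟩
  simp only [lt_min_iff] at hlt
  obtain ⟨⟨hltα, hltβ⟩, hsα, hsβ⟩ := hlt
  rw [← div_lt_iff₀ hαn, lt_min_iff] at hsα
  rw [← div_lt_iff₀ hβn, lt_min_iff] at hsβ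
  have hsα0 : 0 < r / ‖αOut‖ := by positivity
  have hsβ0 : 0 < r / ‖βIn‖ := by positivity
  let s : unitInterval := ⟨r / ‖αOut‖, hsα0.le, by linarith⟩
  let τ' : unitInterval := ⟨r / ‖βIn‖, hsβ0.le, by linarith⟩
  let τ : unitInterval := unitInterval.symm τ'
  have hs : (s : ℝ) = r / ‖αOut‖ := rfl
  have hτ' : (τ' : ℝ) = r / ‖βIn‖ := rfl
  have hτ : (τ : ℝ) = 1 - r / ‖βIn‖ := rfl
  have htar : ∀ θ, circlePoint r θ ∈ φ.target := fun θ =>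
    hballα (mem_ball_zero_iff.2 (by rwa [norm_circlePoint hr]))
  have hβτ : φ.symm (circlePoint r θ₀) = β τ := by
    obtain ⟨h1, h2⟩ := (Eβ τ' hsβ.1.le).2
    rw [← h₀.smul_eq_circlePoint, ← hτ', ← h2, φ.left_inv h1]
  have hαs : φ.symm (circlePoint r θ₁) = α s := by
    obtain ⟨h1, h2⟩ := (Eα s hsα.1.le).1
    rw [← h₁.smul_eq_circlePoint, ← hs, ← h2, φ.left_inv h1]
  let ang : unitInterval → ℝ := fun u => θ₀ + u * (θ₁ - θ₀)
  have hang : ∀ u, ang u ∈ Icc θ₁ θ₀ := fun u => by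
    constructor <;> simp only [ang] <;> nlinarith [u.2.1, u.2.2]
  let η : Path (β τ) (α s) :=
    { toFun := fun u => φ.symm (circlePoint r (ang u))
      continuous_toFun := φ.continuousOn_symm.comp_continuous
        ((continuous_circlePoint r).comp (by fun_prop)) fun u => htar _
      source' := by simpa [ang] using hβτ
      target' := by simpa [ang] using hαs }
  have hηu : ∀ u, η u = φ.symm (circlePoint r (ang u)) := fun _ => rfl
  -- The sector is less than a full turn, so a direction has at most one argument in it.
  have harg : ∀ {θ θ' : ℝ} {z : ℂ}, θ ∈ Icc θ₁ θ₀ → θ' ∈ Icc θ₁ θ₀ → HasArg z θ → HasArg z θ' →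
      θ = θ' := fun h h' hz hz' => hz.unique hz' (by
    rw [abs_lt]; constructor <;> linarith [h.1, h.2, h'.1, h'.2])
  have hang_inj : Function.Injective ang := fun u u' h => by
    have h' : (u : ℝ) * (θ₁ - θ₀) = u' * (θ₁ - θ₀) := by simpa [ang] using h
    exact Subtype.ext (mul_right_cancel₀ (sub_ne_zero.2 h01.ne) h')
  have hη : Function.Injective η := fun u u' h => by
    have h' := φ.symm.injOn (htar _) (htar _) h
    exact hang_inj (harg (hang u) (hang u') (hasArg_circlePoint hr _)
      (h' ▸ hasArg_circlePoint hr _))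
  have hηα : range η ∩ range α ⊆ {α s} := by
    rintro _ ⟨⟨u, rfl⟩, hu⟩
    rcases Hα r (ang u) hr hltα hu with h | h
    · rw [mem_singleton_iff, hηu, harg (hang u) ⟨le_rfl, h01.le⟩ h h₁, hαs]
    · exact absurd h (hfree _ (hang u)).1
  have hηβ : range η ∩ range β ⊆ {β τ} := by
    rintro _ ⟨⟨u, rfl⟩, hu⟩
    rcases Hβ r (ang u) hr hltβ hu with h | h
    · exact absurd h (hfree _ (hang u)).2
    · rw [mem_singleton_iff, hηu, harg (hang u) ⟨h01.le, le_rfl⟩ h h₀, hβτ]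
  have hrest : Function.Injective (η.trans (finalPart α s)) :=
    trans_injective hη (finalPart_injective hα hsα0 (by linarith))
      ((inter_subset_inter_right _ (range_finalPart_subset α s)).trans hηα)
  refine ⟨(initialPart β τ).trans (η.trans (finalPart α s)), ?_, ?_, ?_, ?_⟩
  · refine isSimpleContour_trans (initialPart_injective hβ (by linarith) (by linarith)) hrest ?_
    rw [Path.trans_range]
    rintro x ⟨hx, hx' | hx'⟩
    · exact .inr (hηβ ⟨hx', range_initialPart_subset β τ hx⟩)
    · exact .inl (hαβ ▸ ⟨range_finalPart_subset α s hx', range_initialPart_subset β τ hx⟩ :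
        x ∈ ({p} : Set P))
  · have hmem : ∀ t, ((finalPart β τ).trans (initialPart α s)) t ∈ φ.source ∧
        φ (((finalPart β τ).trans (initialPart α s)) t) ∈ Metric.closedBall (0 : ℂ) r := by
      suffices h : range ((finalPart β τ).trans (initialPart α s)) ⊆
          {x | x ∈ φ.source ∧ φ x ∈ Metric.closedBall (0 : ℂ) r} from fun t => h ⟨t, rfl⟩
      rw [Path.trans_range]
      rintro _ (⟨u, rfl⟩ | ⟨u, rfl⟩)
      · have hu : finalPart β τ u = β (unitInterval.symm (unitInterval.symm u * τ')) := by
          rw [finalPart_apply]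
          congr 1
          exact Subtype.ext (by simp [τ]; ring)
        have hle : ((unitInterval.symm u * τ' : unitInterval) : ℝ) ≤ τ' := by
          rw [Set.Icc.coe_mul]
          exact mul_le_of_le_one_left τ'.2.1 (unitInterval.symm u).2.2
        obtain ⟨h1, h2⟩ := (Eβ (unitInterval.symm u * τ') (hle.trans hsβ.1.le)).2
        rw [hu]
        refine ⟨h1, ?_⟩
        rw [h2, mem_closedBall_zero_iff, norm_smul, Real.norm_of_nonneg (unitInterval.nonneg _),
          ← le_div_iff₀ hβn]
        exact hle
      · have hle : ((s * u : unitInterval) : ℝ) ≤ s := by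
          rw [Set.Icc.coe_mul]
          exact mul_le_of_le_one_right s.2.1 u.2.2
        obtain ⟨h1, h2⟩ := (Eα (s * u) (hle.trans hsα.1.le)).1
        rw [initialPart_apply]
        refine ⟨h1, ?_⟩
        rw [h2, mem_closedBall_zero_iff, norm_smul, Real.norm_of_nonneg (unitInterval.nonneg _),
          ← le_div_iff₀ hαn]
        exact hle
    -- The corner through `p` and the arc replacing it both lie in the closed disc of radius `r`.
    -- Convexity of the disc is enough, so the sector may be wider than π.
    have hhom : ((finalPart β τ).trans (initialPart α s)).Homotopic η := by
      refine homotopic_of_mem_convex φ (convex_closedBall 0 r)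
        ((Metric.closedBall_subset_ball hltα).trans hballα) _ _ hmem fun u => ?_
      rw [hηu, φ.right_inv (htar _)]
      exact ⟨φ.map_target (htar _), by simp [norm_circlePoint hr]⟩
    change Path.Homotopic.Quotient.mk _ =
      (Path.Homotopic.Quotient.mk β).trans (Path.Homotopic.Quotient.mk α)
    rw [← Path.Homotopic.Quotient.eq.2 (homotopic_initialPart_trans_finalPart β τ),
      ← Path.Homotopic.Quotient.eq.2 (homotopic_initialPart_trans_finalPart α s)]
    simp only [Path.Homotopic.Quotient.mk_trans]
    rw [← Path.Homotopic.Quotient.eq.2 hhom]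
    simp only [Path.Homotopic.Quotient.mk_trans, Path.Homotopic.Quotient.trans_assoc]
  -- The concatenation spends time 1/2 on the initial part of `β`, then 1/4 on the arc and 1/4 on
  -- the final part of `α`, hence the speeds. The bound 1/8 keeps both ends inside the outer pieces.
  · refine ⟨2 * τ, 4 * (1 - s), by linarith, by linarith,
      min (1 / 8) (min (εα / 4) (εβ / 2)), by positivity, fun t ht => ?_⟩
    simp only [le_min_iff] at ht
    obtain ⟨ht8, htα, htβ⟩ := ht
    constructor
    · let t' : unitInterval := ⟨2 * t, by linarith [t.2.1], by linarith⟩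
      have hval : ((initialPart β τ).trans (η.trans (finalPart α s))) t = β (τ * t') := by
        rw [Path.trans_apply, dif_pos (by linarith), initialPart_apply]
      have hle : ((τ * t' : unitInterval) : ℝ) ≤ εβ := by
        rw [Set.Icc.coe_mul]
        refine (mul_le_of_le_one_left t'.2.1 τ.2.2).trans ?_
        change 2 * (t : ℝ) ≤ εβ
        linarith
      rw [hval]
      refine ⟨(Eβ _ hle).1.1, ?_⟩
      rw [(Eβ _ hle).1.2, smul_smul, Set.Icc.coe_mul]
      congr 1
      change (τ : ℝ) * (2 * t) = _
      ring
    · let t' : unitInterval := ⟨4 * t, by linarith [t.2.1], by linarith⟩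
      have hval : ((initialPart β τ).trans (η.trans (finalPart α s))) (unitInterval.symm t) =
          α (unitInterval.symm (unitInterval.symm s * t')) := by
        rw [Path.trans_apply, dif_neg (by rw [unitInterval.coe_symm_eq]; linarith),
          Path.trans_apply, dif_neg (by simp only [unitInterval.coe_symm_eq]; linarith),
          finalPart_apply]
        congr 1
        exact Subtype.ext (by simp [t']; ring)
      have hle : ((unitInterval.symm s * t' : unitInterval) : ℝ) ≤ εα := by
        rw [Set.Icc.coe_mul]
        refine (mul_le_of_le_one_left t'.2.1 (unitInterval.symm s).2.2).trans ?_
        change 4 * (t : ℝ) ≤ εα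
        linarith
      rw [hval]
      refine ⟨(Eα _ hle).2.1, ?_⟩
      rw [(Eα _ hle).2.2, smul_smul, Set.Icc.coe_mul]
      congr 1
      change (1 - (s : ℝ)) * (4 * t) = _
      ring
  · rw [Path.trans_range, Path.trans_range]
    refine union_subset ((range_initialPart_subset β τ).trans fun x hx => .inl (.inr hx))
      (union_subset ?_ ((range_finalPart_subset α s).trans fun x hx => .inl (.inl hx)))
    rintro _ ⟨u, rfl⟩
    exact .inr ⟨ang u, hang u, rfl⟩

end Corners

/-! ### Characters of a group with a standard presentation -/

/-- In a group with the presentation of a standard basis the generators `aᵢ`, `bᵢ` are independent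
modulo commutators. -/
lemma Family.IsPresentation.exists_character {G : Type*} [Group G] {g n : ℕ} {v : Family G g n}
    (hv : v.IsPresentation) (w w' : Fin g → Multiplicative ℤ) :
    ∃ χ : G →* Multiplicative ℤ, (∀ i, χ (v.a i) = w i) ∧ (∀ i, χ (v.b i) = w' i) ∧
      ∀ j, χ (v.c j) = 1 := by
  let f : FreeGroup (Fin g ⊕ Fin g ⊕ Fin n) →* Multiplicative ℤ :=
    FreeGroup.lift (Family.get ⟨w, w', fun _ => 1⟩)
  have hf : (FreeGroup.lift v.get).ker ≤ f.ker := by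
    rw [hv.2]
    refine Subgroup.normalClosure_le_normal ?_
    rintro _ rfl
    -- The target is commutative and every `cⱼ` goes to 1, so the defining relator is killed.
    have h1 : ∀ i, f (groupComm ((Family.free g n).a i) ((Family.free g n).b i)) = 1 := fun i => by
      simp only [groupComm, map_mul, map_inv]
      rw [mul_comm (f _) (f _), mul_inv_cancel_right, mul_inv_cancel]
    have h2 : ∀ j, f ((Family.free g n).c j) = 1 := fun j => by
      simp [f, Family.free, Family.get]
    simp [Family.relator, map_list_prod, Function.comp_def, List.map_ofFn, h1, h2]
  let χ : G →* Multiplicative ℤ := (FreeGroup.lift v.get).liftOfSurjective hv.1 ⟨f, hf⟩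
  have hχ : ∀ i, χ (v.get i) = f (.of i) := fun i => by
    have := MonoidHom.liftOfRightInverse_comp_apply (FreeGroup.lift v.get) _
      (Function.rightInverse_surjInv hv.1) ⟨f, hf⟩ (.of i)
    simpa using this
  refine ⟨χ, fun i => ?_, fun i => ?_, fun j => ?_⟩
  · simpa [f, Family.get] using hχ (.inl i)
  · simpa [f, Family.get] using hχ (.inr (.inl i))
  · simpa [f, Family.get] using hχ (.inr (.inr j))

/-! ### Pairs of contours -/

section Pairs

variable {P : Type*} [TopologicalSpace P] {p : P}

lemma inv_mem_simpleClasses {x : FundamentalGroup P p} (hx : x ∈ simpleClasses P p) :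
    x⁻¹ ∈ simpleClasses P p := by
  obtain ⟨hx1, α, hα, rfl⟩ := hx
  exact ⟨inv_ne_one.2 hx1, α.symm, hα.symm, contourClass_symm α⟩

lemma localIndex_ne_zero {aIn aOut bIn bOut : ℂ}
    (h : Clockwise [aIn, bOut, aOut, bIn] ∨ Clockwise [aIn, bIn, aOut, bOut]) :
    localIndex aIn aOut bIn bOut ≠ 0 := by
  unfold localIndex
  split_ifs with h₁ h₂
  · simp
  · simp
  · exact (h.elim h₁ h₂).elim

/-- Simple contours that meet once and whose ends occur in the order `y` arriving, `x` leaving,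
`x` arriving, `y` leaving can be joined to a simple contour. -/
lemma mul_mem_simpleClasses [T2Space P] {φ : OpenPartialHomeomorph P ℂ} {α β : Path p p}
    {αOut αIn βOut βIn : ℂ} (hα : IsSimpleContour α) (hβ : IsSimpleContour β)
    (hαβ : range α ∩ range β = {p}) (eα : HasEnds φ α αOut αIn) (eβ : HasEnds φ β βOut βIn)
    (h : Clockwise [βIn, αOut, αIn, βOut]) (hne : contourClass α * contourClass β ≠ 1) :
    contourClass α * contourClass β ∈ simpleClasses P p := by
  obtain ⟨θ₀, θ₁, θ₂, θ₃, ⟨h01, h12, h23, h03⟩, h₀, h₁, h₂, h₃⟩ := clockwise_four.1 h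
  -- The other two directions come after the sector within the same turn, so they have no argument
  -- inside it.
  have hno : ∀ θ ∈ Icc θ₁ θ₀, ∀ {θ' : ℝ} {z : ℂ}, θ' < θ₁ → θ₃ ≤ θ' → HasArg z θ' →
      ¬ HasArg z θ := by
    intro θ hθ θ' z hlt hle hz hz'
    have := hz'.unique hz (abs_lt.2 ⟨by linarith [hθ.1, hθ.2], by linarith [hθ.1, hθ.2]⟩)
    linarith [hθ.1]
  obtain ⟨r₀, hr₀, H⟩ := exists_cut_corner hα hβ hαβ eα eβ h01 (by linarith) h₀ h₁
    fun θ hθ => ⟨hno θ hθ h12 h23.le h₂, hno θ hθ (by linarith) le_rfl h₃⟩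
  obtain ⟨δ, hδ, hδc, -, -⟩ := H (r₀ / 2) (by positivity) (by linarith)
  exact ⟨hne, δ, hδ, hδc⟩

variable [ChartedSpace ℂ P]

lemma IsNegativePair.mul_mem [T2Space P] {x y : FundamentalGroup P p} (h : IsNegativePair x y)
    (hne : x * y ≠ 1) : x * y ∈ simpleClasses P p := by
  obtain ⟨α, β, φ, xIn, xOut, yIn, yOut, hα, hβ, rfl, rfl, hαβ, -, eα, eβ, h⟩ := h
  exact mul_mem_simpleClasses hα hβ hαβ eα eβ h.rotate hne

lemma IsNegativePair.symm {x y : FundamentalGroup P p} (h : IsNegativePair x y) :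
    IsNegativePair y x := by
  obtain ⟨α, β, φ, xIn, xOut, yIn, yOut, hα, hβ, hx, hy, hαβ, hφ, eα, eβ, h⟩ := h
  exact ⟨β, α, φ, yIn, yOut, xIn, xOut, hβ, hα, hy, hx, by rwa [inter_comm], hφ, eβ, eα,
    h.rotate.rotate⟩

end Pairs

/-! ### Pairs in a standard basis -/

lemma sublist_flatten_ofFn {X : Type*} {n : ℕ} (F : Fin n → List X) (i : Fin n) :
    (F i).Sublist (List.ofFn F).flatten := by
  have h : [F i].Sublist (List.ofFn F) := List.singleton_sublist.2 (List.mem_ofFn.2 ⟨i, rfl⟩)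
  simpa using h.flatten

lemma append_sublist_flatten_ofFn {X : Type*} {n : ℕ} (F : Fin n → List X) {i j : Fin n}
    (hij : i < j) : (F i ++ F j).Sublist (List.ofFn F).flatten := by
  have h0 : [i, j].Sublist (List.finRange n) := by
    refine List.sublist_of_subperm_of_sortedLE ?_ ?_ (List.sortedLT_finRange n).sortedLE
    · exact List.Nodup.subperm (by simp [hij.ne]) (by simp)
    · simp [List.sortedLE_iff_pairwise, hij.le]
  have h : [F i, F j].Sublist (List.ofFn F) := by
    rw [List.ofFn_eq_map]
    exact h0.map F
  simpa using h.flatten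

lemma handle_sublist_basisEnds {g n : ℕ} (out inn : Family ℂ g n) (i : Fin g) :
    [inn.a i, out.b i, out.a i, inn.b i].Sublist (basisEnds out inn) :=
  (sublist_flatten_ofFn (fun i => [inn.a i, out.b i, out.a i, inn.b i]) i).trans
    (List.sublist_append_left _ _)

lemma handles_sublist_basisEnds {g n : ℕ} (out inn : Family ℂ g n) {i j : Fin g} (h : i < j) :
    [inn.a i, out.b i, out.a i, inn.b i, inn.a j, out.b j, out.a j, inn.b j].Sublist
      (basisEnds out inn) :=
  (append_sublist_flatten_ofFn (fun i => [inn.a i, out.b i, out.a i, inn.b i]) h).trans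
    (List.sublist_append_left _ _)

lemma handle_boundary_sublist_basisEnds {g n : ℕ} (out inn : Family ℂ g n) (i : Fin g)
    (j : Fin n) : [inn.a i, out.b i, out.a i, inn.b i, inn.c j, out.c j].Sublist
      (basisEnds out inn) :=
  (sublist_flatten_ofFn (fun i => [inn.a i, out.b i, out.a i, inn.b i]) i).append
    (sublist_flatten_ofFn (fun j => [inn.c j, out.c j]) j)

section Basis

variable {P : Type*} [TopologicalSpace P] {p : P} [ChartedSpace ℂ P] {g lh lp : ℕ}
  {v : Family (simpleClasses P p) g (lh + lp)}

lemma IsStandardBasis.isCrossingPair_a_b (hv : IsStandardBasis v) (i : Fin g) :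
    IsCrossingPair (v.a i : FundamentalGroup P p) (v.b i) := by
  obtain ⟨-, κ, hs, hc, hm, -, -, φ, out, inn, hφ, he, hcw⟩ := hv
  refine ⟨κ.a i, κ.b i, φ, inn.a i, out.a i, inn.b i, out.b i, hs (.inl i), hs (.inr (.inl i)),
    hc (.inl i), hc (.inr (.inl i)), hm (.inl i) (.inr (.inl i)) (by simp), hφ, he (.inl i),
    he (.inr (.inl i)), localIndex_ne_zero (.inl ?_)⟩
  exact hcw.sublist (handle_sublist_basisEnds out inn i)

lemma IsStandardBasis.isCrossingPair_b_a (hv : IsStandardBasis v) (i : Fin g) :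
    IsCrossingPair (v.b i : FundamentalGroup P p) (v.a i) := by
  obtain ⟨-, κ, hs, hc, hm, -, -, φ, out, inn, hφ, he, hcw⟩ := hv
  refine ⟨κ.b i, κ.a i, φ, inn.b i, out.b i, inn.a i, out.a i, hs (.inr (.inl i)), hs (.inl i),
    hc (.inr (.inl i)), hc (.inl i), hm (.inr (.inl i)) (.inl i) (by simp), hφ,
    he (.inr (.inl i)), he (.inl i), localIndex_ne_zero (.inr (Clockwise.rotate ?_))⟩
  exact hcw.sublist (handle_sublist_basisEnds out inn i)

lemma IsStandardBasis.isCrossingPair_b_inv_a (hv : IsStandardBasis v) (i : Fin g) :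
    IsCrossingPair (v.b i : FundamentalGroup P p) (v.a i : FundamentalGroup P p)⁻¹ := by
  obtain ⟨-, κ, hs, hc, hm, -, -, φ, out, inn, hφ, he, hcw⟩ := hv
  refine ⟨κ.b i, (κ.a i).symm, φ, inn.b i, out.b i, out.a i, inn.a i, hs (.inr (.inl i)),
    (hs (.inl i)).symm, hc (.inr (.inl i)), ?_, ?_, hφ,
    he (.inr (.inl i)), HasEnds.symm (he (.inl i)), localIndex_ne_zero (.inl (Clockwise.rotate ?_))⟩
  · rw [contourClass_symm]
    exact congrArg _ (hc (.inl i))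
  · rw [Path.symm_range]
    exact hm (.inr (.inl i)) (.inl i) (by simp)
  · exact hcw.sublist (handle_sublist_basisEnds out inn i)

/-- Inverting `aⱼ` exchanges its ends. Ends of different handles are not interleaved, and in its
handle `bᵢ` leaves before it arrives while `aⱼ` arrives before it leaves. For `j < i` the list
starts with the ends of `aⱼ` and needs half a rotation. -/
lemma IsStandardBasis.isNegativePair_b_inv_a_of_ne (hv : IsStandardBasis v) {i j : Fin g}
    (hij : i ≠ j) :
    IsNegativePair (v.b i : FundamentalGroup P p) (v.a j : FundamentalGroup P p)⁻¹ := by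
  obtain ⟨-, κ, hs, hc, hm, -, -, φ, out, inn, hφ, he, hcw⟩ := hv
  refine ⟨κ.b i, (κ.a j).symm, φ, inn.b i, out.b i, out.a j, inn.a j, hs (.inr (.inl i)),
    (hs (.inl j)).symm, hc (.inr (.inl i)), ?_, ?_, hφ,
    he (.inr (.inl i)), HasEnds.symm (he (.inl j)), ?_⟩
  · rw [contourClass_symm]
    exact congrArg _ (hc (.inl j))
  · rw [Path.symm_range]
    exact hm (.inr (.inl i)) (.inl j) (by simp)
  · rcases hij.lt_or_gt with h | h
    · refine hcw.sublist (.trans ?_ (handles_sublist_basisEnds out inn h))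
      exact .cons _ (.cons_cons _ (.cons _ (.cons_cons _ (.cons_cons _ (.cons _ (.cons_cons _
        (.cons _ .slnil)))))))
    · refine (Clockwise.rotate (Clockwise.rotate (hcw.sublist (.trans ?_
        (handles_sublist_basisEnds out inn h)))))
      exact .cons_cons _ (.cons _ (.cons_cons _ (.cons _ (.cons _ (.cons_cons _ (.cons _
        (.cons_cons _ .slnil)))))))

/-- The product `bᵢ aᵢ` is represented by a simple contour that does not meet the contour of `cⱼ`
outside the base point. -/
lemma IsStandardBasis.b_mul_a [T2Space P] (hv : IsStandardBasis v) (i : Fin g) (j : Fin (lh + lp))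
    (hne : (v.b i : FundamentalGroup P p) * (v.a i : FundamentalGroup P p) ≠ 1) :
    (v.b i : FundamentalGroup P p) * (v.a i : FundamentalGroup P p) ∈ simpleClasses P p ∧
      IsNegativePair ((v.b i : FundamentalGroup P p) * (v.a i : FundamentalGroup P p))
        (v.c j : FundamentalGroup P p)⁻¹ := by
  obtain ⟨-, κ, hs, hc, hm, -, -, φ, out, inn, hφ, he, hcw⟩ := hv
  have h6 : Clockwise [inn.a i, out.b i, out.a i, inn.b i, inn.c j, out.c j] :=
    hcw.sublist (handle_boundary_sublist_basisEnds out inn i j)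
  have h4 : Clockwise [out.a i, inn.b i, inn.c j, out.c j] :=
    h6.sublist (.cons _ (.cons _ (.refl _)))
  obtain ⟨L, hL, h⟩ := clockwise_iff.1 h6
  simp only [List.forall₂_cons_left_iff, List.forall₂_nil_left_iff] at h
  obtain ⟨θ₁, _, h₁, ⟨θ₂, _, h₂, ⟨θ₃, _, h₃, ⟨θ₄, _, h₄, ⟨θ₅, _, h₅, ⟨θ₆, _, h₆, rfl, rfl⟩, rfl⟩,
    rfl⟩, rfl⟩, rfl⟩, rfl⟩ := h
  simp only [TurnsClockwise, List.pairwise_cons, List.mem_cons, List.not_mem_nil, or_false,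
    forall_eq_or_imp, forall_eq, IsEmpty.forall_iff, implies_true, List.Pairwise.nil,
    and_true] at hL
  obtain ⟨⟨⟨h12, -⟩, -, -, -, -, h16⟩, ⟨⟨h23, -⟩, -⟩, ⟨⟨h34, -⟩, -⟩, ⟨⟨h45, -⟩, -⟩, h56, -⟩ := hL
  -- The corner to be cut is where `aᵢ` arrives and `bᵢ` leaves. The remaining four directions,
  -- including those of `cⱼ`, lie outside this sector.
  have hno : ∀ θ ∈ Icc θ₂ θ₁, ∀ {θ' : ℝ} {z : ℂ}, θ' < θ₂ → θ₆ ≤ θ' → HasArg z θ' →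
      ¬ HasArg z θ := by
    intro θ hθ θ' z hlt hle hz hz'
    have := hz'.unique hz (abs_lt.2 ⟨by linarith [hθ.1, hθ.2], by linarith [hθ.1, hθ.2]⟩)
    linarith [hθ.1]
  have ca : contourClass (κ.a i) = v.a i := hc (.inl i)
  have cb : contourClass (κ.b i) = v.b i := hc (.inr (.inl i))
  have cc : contourClass (κ.c j) = v.c j := hc (.inr (.inr j))
  obtain ⟨r₀, hr₀, H⟩ := exists_cut_corner (hs (.inr (.inl i))) (hs (.inl i))
    (hm (.inr (.inl i)) (.inl i) (by simp)) (he (.inr (.inl i))) (he (.inl i)) h12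
    (by linarith) h₁ h₂ fun θ hθ => ⟨hno θ hθ (by linarith) (by linarith) h₄,
      hno θ hθ h23 (by linarith) h₃⟩
  -- Shrinking the circle further makes the arc disjoint from the contour of `cⱼ` as well.
  obtain ⟨r₁, hr₁, -, H₁⟩ := (he (.inr (.inr j))).exists_radius_hasArg (hs (.inr (.inr j)))
  have hmin : 0 < min r₀ r₁ := lt_min hr₀ hr₁
  obtain ⟨δ, hδ, hδc, ⟨k, k', hk, hk', eδ⟩, hδr⟩ := H (min r₀ r₁ / 2) (by positivity)
    (by linarith [min_le_left r₀ r₁])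
  have hδc' : contourClass δ = (v.b i : FundamentalGroup P p) * (v.a i : FundamentalGroup P p) := by
    rw [← ca, ← cb]; exact hδc
  refine ⟨⟨hne, δ, hδ, hδc'⟩, δ, (κ.c j).symm, φ, k' • inn.b i, k • out.a i, out.c j, inn.c j, hδ,
    IsSimpleContour.symm (hs (.inr (.inr j))), hδc', by rw [contourClass_symm, cc], ?_, hφ, eδ,
    HasEnds.symm (he (.inr (.inr j))), ?_⟩
  · rw [Path.symm_range]
    refine Subset.antisymm ?_ (singleton_subset_iff.2 ⟨⟨0, δ.source⟩, ⟨0, Path.source _⟩⟩)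
    rintro x ⟨hx, hx'⟩
    rcases hδr hx with (hx | hx) | ⟨θ, hθ, rfl⟩
    · exact (hm (.inr (.inl i)) (.inr (.inr j)) (by simp)).subset ⟨hx, hx'⟩
    · exact (hm (.inl i) (.inr (.inr j)) (by simp)).subset ⟨hx, hx'⟩
    · rcases H₁ _ θ (by positivity) (by linarith [min_le_right r₀ r₁]) hx' with h | h
      · exact absurd h (hno θ hθ (by linarith) le_rfl h₆)
      · exact absurd h (hno θ hθ (by linarith) (by linarith) h₅)
  · simpa using h4.smul hk hk' one_pos one_pos

end Basis

/-! ### Values of Arf functions -/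

section Arf

variable {P : Type*} [TopologicalSpace P] {p : P} [ChartedSpace ℂ P] {m : ℕ}
  {σ : simpleClasses P p → ZMod m}

/-- An Arf function is invariant under conjugation by all elements of the fundamental group that
simple contours generate. -/
lemma IsArf.conj_of_surjective [T2Space P] (hσ : IsArf σ) {ι : Type*} (w : ι → simpleClasses P p)
    (hw : Function.Surjective (FreeGroup.lift fun i => (w i : FundamentalGroup P p)))
    (y : FundamentalGroup P p) {x z : simpleClasses P p}
    (h : (z : FundamentalGroup P p) = y * x * y⁻¹) : σ z = σ x := by
  obtain ⟨W, rfl⟩ := hw y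
  induction W using FreeGroup.induction_on generalizing x z with
  | C1 =>
    simp only [map_one, one_mul, inv_one, mul_one] at h
    rw [Subtype.ext h]
  | of i => exact hσ.conj x (w i) z (by simpa using h)
  | inv_of i _ => exact hσ.conj x ⟨_, inv_mem_simpleClasses (w i).2⟩ z (by simpa using h)
  | mul W W' ih ih' =>
    -- `σ` has to be defined on the intermediate conjugate before the two halves of the word can be
    -- treated separately.
    have hx := mul_mul_inv_mem_simpleClasses x.2
      (FreeGroup.lift (fun i => (w i : FundamentalGroup P p)) W')
    rw [← ih' (z := ⟨_, hx⟩) rfl]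
    refine ih ?_
    rw [h, map_mul]
    group

end Arf

lemma eq_update_update_iff {ι X : Type*} [DecidableEq ι] {f F : ι → X} {i j : ι} {x y : X}
    (hij : i ≠ j) : F = Function.update (Function.update f i x) j y ↔
      F i = x ∧ F j = y ∧ ∀ k, k ≠ i → k ≠ j → F k = f k := by
  rw [Function.eq_update_iff]
  constructor
  · rintro ⟨h1, h2⟩
    refine ⟨by simpa using h2 i hij, h1, fun k hi hj => ?_⟩
    simpa [hi] using h2 k hj
  · rintro ⟨h1, h2, h3⟩
    refine ⟨h2, fun k hk => ?_⟩
    rcases eq_or_ne k i with rfl | hi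
    · simpa using h1
    · simpa [hi] using h3 k hi hk

/-! ### Values on the short words needed for twists 2 and 3 -/

section Twists

variable {P : Type*} [TopologicalSpace P] {p : P} [ChartedSpace ℂ P] {m : ℕ}
  {σ : simpleClasses P p → ZMod m} {g lh lp : ℕ} {v : Family (simpleClasses P p) g (lh + lp)}

lemma IsArf.conj_of_isStandardBasis [T2Space P] (hσ : IsArf σ) (hv : IsStandardBasis v)
    (y : FundamentalGroup P p) {x z : simpleClasses P p}
    (h : (z : FundamentalGroup P p) = y * x * y⁻¹) : σ z = σ x := by
  refine hσ.conj_of_surjective v.get ?_ y h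
  convert hv.1.1 using 3
  funext i
  rcases i with i | i | i <;> rfl

lemma IsStandardBasis.b_mul_inv_a_ne_one (hv : IsStandardBasis v) (i j : Fin g) :
    (v.b i : FundamentalGroup P p) * (v.a j : FundamentalGroup P p)⁻¹ ≠ 1 := by
  intro h
  obtain ⟨χ, ha, hb, -⟩ := hv.1.exists_character 1 fun _ => Multiplicative.ofAdd 1
  have ha' : χ (v.a j) = 1 := ha j
  have hb' : χ (v.b i) = Multiplicative.ofAdd 1 := hb i
  have := congrArg χ h
  rw [map_mul, map_inv, ha', hb', map_one χ, inv_one, mul_one] at this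
  exact absurd this (by decide)

/-- The value of an Arf function on `bᵢ aⱼ⁻¹` for `i ≠ j`. -/
lemma IsArf.b_mul_inv_a [T2Space P] (hσ : IsArf σ) (hv : IsStandardBasis v) {i j : Fin g}
    (hij : i ≠ j) : ∃ z : simpleClasses P p,
      (z : FundamentalGroup P p) = v.b i * (v.a j : FundamentalGroup P p)⁻¹ ∧
        σ z = σ (v.b i) - σ (v.a j) - 1 := by
  have hneg := hv.isNegativePair_b_inv_a_of_ne hij
  refine ⟨⟨_, hneg.mul_mem (hv.b_mul_inv_a_ne_one i j)⟩, rfl, ?_⟩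
  rw [hσ.negative (v.b i) ⟨_, inv_mem_simpleClasses (v.a j).2⟩ _ rfl hneg,
    hσ.inv (v.a j) ⟨_, inv_mem_simpleClasses (v.a j).2⟩ rfl]
  ring

/-- Additivity gives the value on `bᵢaᵢ`. A contour of this product meets `cⱼ` only at the base
point, without crossing, so multiplying by `cⱼ⁻¹` costs the -1 of axiom (iv). The character with
`aᵢ`, `cⱼ` ↦ 0 and `bᵢ` ↦ 1 shows that the products are nontrivial. -/
lemma IsArf.inv_c_mul_b_mul_a [T2Space P] (hσ : IsArf σ) (hv : IsStandardBasis v) (i : Fin g)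
    (j : Fin (lh + lp)) : ∃ z : simpleClasses P p,
      (z : FundamentalGroup P p) =
        (v.c j : FundamentalGroup P p)⁻¹ * ((v.b i : FundamentalGroup P p) * v.a i) ∧
      σ z = σ (v.a i) + σ (v.b i) - σ (v.c j) - 1 := by
  obtain ⟨χ, ha, hb, hc⟩ := hv.1.exists_character 1 fun _ => Multiplicative.ofAdd 1
  have ha' : χ (v.a i) = 1 := ha i
  have hb' : χ (v.b i) = Multiplicative.ofAdd 1 := hb i
  have hc' : χ (v.c j) = 1 := hc j
  have hne : (v.b i : FundamentalGroup P p) * (v.a i : FundamentalGroup P p) ≠ 1 := fun h => by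
    have := congrArg χ h
    rw [map_mul, ha', hb', map_one χ, mul_one] at this
    exact absurd this (by decide)
  have hne' : (v.c j : FundamentalGroup P p)⁻¹ *
      ((v.b i : FundamentalGroup P p) * (v.a i : FundamentalGroup P p)) ≠ 1 := fun h => by
    have := congrArg χ h
    rw [map_mul, map_mul, map_inv, ha', hb', hc', map_one χ, mul_one, inv_one, one_mul] at this
    exact absurd this (by decide)
  obtain ⟨hba, hneg⟩ := hv.b_mul_a i j hne
  refine ⟨⟨_, hneg.symm.mul_mem hne'⟩, rfl, ?_⟩
  rw [hσ.negative ⟨_, inv_mem_simpleClasses (v.c j).2⟩ ⟨_, hba⟩ _ rfl hneg.symm,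
    hσ.inv (v.c j) ⟨_, inv_mem_simpleClasses (v.c j).2⟩ rfl,
    hσ.crossing (v.b i) (v.a i) ⟨_, hba⟩ rfl (hv.isCrossingPair_b_a i)]
  ring

end Twists

end HigherArf
end

/-! ### The five twists -/

open HigherArf in
theorem mainTheorem10 {P : Type*} [TopologicalSpace P] [T2Space P] [ConnectedSpace P]
    [ChartedSpace ℂ P] [IsManifold 𝓘(ℂ) ω P] (hP : IsHyperbolic P) (p : P)
    (m g lh lp : ℕ) (σ : simpleClasses P p → ZMod m) (hσ : IsArf σ)
    (v v' : Family (simpleClasses P p) g (lh + lp))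
    (hv : IsStandardBasis v) (hv' : IsStandardBasis v')
    (D : DehnTwist g (lh + lp))
    (hD : v'.map Subtype.val = D.onBasis (v.map Subtype.val)) :
    v'.map σ = D.onValues (v.map σ) := by
  have ha := congrArg Family.a hD
  have hb := congrArg Family.b hD
  have hc := congrArg Family.c hD
  have heq : ∀ {x y : simpleClasses P p}, (x : FundamentalGroup P p) = y → σ x = σ y :=
    fun h => congrArg σ (Subtype.ext h)
  have hconj := fun (y : FundamentalGroup P p) {x z : simpleClasses P p}
    (h : (z : FundamentalGroup P p) = y * x * y⁻¹) => hσ.conj_of_isStandardBasis hv y h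
  cases D with
  | one hg =>
    obtain ⟨ha, ha'⟩ := Function.eq_update_iff.1 ha
    exact Family.ext
      (Function.eq_update_iff.2 ⟨hσ.crossing _ _ _ ha (hv.isCrossingPair_a_b _),
        fun i hi => heq (ha' i hi)⟩)
      (funext fun i => heq (congrFun hb i)) (funext fun j => heq (congrFun hc j))
  | two hg =>
    set i₁ : Fin g := ⟨0, by omega⟩ with hi₁
    set i₂ : Fin g := ⟨1, hg⟩ with hi₂
    have hne : i₁ ≠ i₂ := by simp [hi₁, hi₂]
    obtain ⟨ha₁, ha₂, ha⟩ := (eq_update_update_iff hne).1 ha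
    obtain ⟨hb₁, hb₂, hb⟩ := (eq_update_update_iff hne).1 hb
    replace ha₁ : (v'.a i₁ : FundamentalGroup P p) =
      (v.a i₁ * v.a i₂) * v.a i₁ * (v.a i₁ * v.a i₂ : FundamentalGroup P p)⁻¹ := ha₁
    replace ha₂ : (v'.a i₂ : FundamentalGroup P p) =
      v.a i₁ * v.a i₂ * (v.a i₁ : FundamentalGroup P p)⁻¹ := ha₂
    replace hb₁ : (v'.b i₁ : FundamentalGroup P p) =
      (v.a i₁ * v.a i₂) * (v.a i₁ : FundamentalGroup P p)⁻¹ * (v.a i₂ : FundamentalGroup P p)⁻¹ *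
        v.b i₁ * (v.a i₁ * v.a i₂ : FundamentalGroup P p)⁻¹ := hb₁
    replace hb₂ : (v'.b i₂ : FundamentalGroup P p) =
      v.b i₂ * (v.a i₂ : FundamentalGroup P p)⁻¹ * (v.a i₁ : FundamentalGroup P p)⁻¹ := hb₂
    have sa₁ : σ (v'.a i₁) = σ (v.a i₁) := hconj _ ha₁
    have sa₂ : σ (v'.a i₂) = σ (v.a i₂) := hconj _ ha₂
    have sb₁ : σ (v'.b i₁) = σ (v.b i₁) - σ (v.a i₁) - σ (v.a i₂) - 1 := by
      -- Here a₁'b₁' = a₁(b₁a₂⁻¹)a₁⁻¹, and the left side is evaluated with the crossing pair of the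
      -- new basis.
      obtain ⟨z, hz, hσz⟩ := hσ.b_mul_inv_a hv hne
      have hz' := mul_mul_inv_mem_simpleClasses z.2 (v.a i₁ : FundamentalGroup P p)
      have h1 : σ ⟨_, hz'⟩ = σ (v'.a i₁) + σ (v'.b i₁) := by
        refine hσ.crossing _ _ _ ?_ (hv'.isCrossingPair_a_b i₁)
        rw [ha₁, hb₁]
        simp only [hz]
        group
      rw [hconj (z := ⟨_, hz'⟩) _ rfl, hσz, sa₁] at h1
      linear_combination -h1
    have sb₂ : σ (v'.b i₂) = σ (v.b i₂) - σ (v.a i₂) - σ (v.a i₁) - 1 := by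
      -- Here b₂'a₂' = b₂a₁⁻¹, with no conjugation left over.
      obtain ⟨z, hz, hσz⟩ := hσ.b_mul_inv_a hv hne.symm
      have h1 : σ z = σ (v'.b i₂) + σ (v'.a i₂) := by
        refine hσ.crossing _ _ _ ?_ (hv'.isCrossingPair_b_a i₂)
        rw [ha₂, hb₂, hz]
        group
      rw [hσz, sa₂] at h1
      linear_combination -h1
    refine Family.ext (funext fun i => ?_)
      ((eq_update_update_iff hne).2 ⟨sb₁, sb₂, fun i h h' => heq (hb i h h')⟩)
      (funext fun j => heq (congrFun hc j))
    rcases eq_or_ne i i₁ with rfl | h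
    · exact sa₁
    rcases eq_or_ne i i₂ with rfl | h'
    · exact sa₂
    · exact heq (ha i h h')
  | three hg hn =>
    set i : Fin g := ⟨g - 1, by omega⟩
    set j : Fin (lh + lp) := ⟨0, hn⟩
    obtain ⟨ha₁, ha⟩ := Function.eq_update_iff.1 ha
    obtain ⟨hb₁, hb⟩ := Function.eq_update_iff.1 hb
    obtain ⟨hc₁, hc⟩ := Function.eq_update_iff.1 hc
    replace ha₁ : (v'.a i : FundamentalGroup P p) =
      ((v.b i : FundamentalGroup P p)⁻¹ * v.c j) * (v.b i : FundamentalGroup P p)⁻¹ *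
        ((v.b i : FundamentalGroup P p)⁻¹ * v.c j)⁻¹ := ha₁
    replace hb₁ : (v'.b i : FundamentalGroup P p) =
      ((v.b i : FundamentalGroup P p)⁻¹ * v.c j * v.b i) * (v.c j : FundamentalGroup P p)⁻¹ *
        v.b i * v.a i * (v.b i : FundamentalGroup P p)⁻¹ *
        ((v.b i : FundamentalGroup P p)⁻¹ * v.c j * v.b i)⁻¹ := hb₁
    replace hc₁ : (v'.c j : FundamentalGroup P p) =
      (v.b i : FundamentalGroup P p)⁻¹ * v.c j * v.b i := hc₁
    have sa : σ (v'.a i) = -σ (v.b i) := by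
      rw [← hσ.inv (v.b i) ⟨_, inv_mem_simpleClasses (v.b i).2⟩ rfl]
      exact hconj _ ha₁
    have sb : σ (v'.b i) = σ (v.a i) - σ (v.c j) - 1 := by
      -- Here b'a'⁻¹ = c'(c⁻¹ba)c'⁻¹. Since `σ` is -β on a', the β in the value on c⁻¹ba cancels.
      obtain ⟨z, hz, hσz⟩ := hσ.inv_c_mul_b_mul_a hv i j
      have hz' := mul_mul_inv_mem_simpleClasses z.2 (v'.c j : FundamentalGroup P p)
      have h1 : σ ⟨_, hz'⟩ =
          σ (v'.b i) + σ ⟨_, inv_mem_simpleClasses (v'.a i).2⟩ := by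
        refine hσ.crossing _ _ _ ?_ (hv'.isCrossingPair_b_inv_a i)
        simp only [ha₁, hb₁, hc₁, hz]
        group
      rw [hconj (z := ⟨_, hz'⟩) _ rfl, hσz,
        hσ.inv (v'.a i) ⟨_, inv_mem_simpleClasses (v'.a i).2⟩ rfl, sa] at h1
      linear_combination -h1
    have sc : σ (v'.c j) = σ (v.c j) :=
      hconj (v.b i : FundamentalGroup P p)⁻¹ (by rw [hc₁, inv_inv])
    refine Family.ext (Function.eq_update_iff.2 ⟨sa, fun k hk => heq (ha k hk)⟩)
      (Function.eq_update_iff.2 ⟨sb, fun k hk => heq (hb k hk)⟩) (funext fun k => ?_)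
    rcases eq_or_ne k j with rfl | h
    · exact sc
    · exact heq (hc k h)
  | four k hk =>
    -- Handles are exchanged up to conjugation by a product of commutators, which need not be a
    -- simple class. Invariance under the whole group is what applies.
    have hne : (⟨k, by omega⟩ : Fin g) ≠ ⟨k + 1, hk⟩ := by simp
    obtain ⟨ha₁, ha₂, ha⟩ := (eq_update_update_iff hne).1 ha
    obtain ⟨hb₁, hb₂, hb⟩ := (eq_update_update_iff hne).1 hb
    exact Family.ext
      ((eq_update_update_iff hne).2 ⟨heq ha₁, hconj _ ha₂, fun i h h' => heq (ha i h h')⟩)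
      ((eq_update_update_iff hne).2 ⟨heq hb₁, hconj _ hb₂, fun i h h' => heq (hb i h h')⟩)
      (funext fun j => heq (congrFun hc j))
  | five k hk =>
    have hne : (⟨k, by omega⟩ : Fin (lh + lp)) ≠ ⟨k + 1, hk⟩ := by simp
    obtain ⟨hc₁, hc₂, hc⟩ := (eq_update_update_iff hne).1 hc
    replace hc₂ : (v'.c ⟨k + 1, hk⟩ : FundamentalGroup P p) =
      (v.c ⟨k + 1, hk⟩ : FundamentalGroup P p)⁻¹ * v.c ⟨k, by omega⟩ * v.c ⟨k + 1, hk⟩ := hc₂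
    refine Family.ext (funext fun i => heq (congrFun ha i)) (funext fun i => heq (congrFun hb i))
      ((eq_update_update_iff hne).2 ⟨heq hc₁, ?_, fun i h h' => heq (hc i h h')⟩)
    exact hconj (v.c ⟨k + 1, hk⟩ : FundamentalGroup P p)⁻¹ (by rw [hc₂, inv_inv])
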